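/- Let $G$ be a finite group and let $\chi$ be an irreducible complex character of $G$ of $2$-height zero, that is, the $2$-part of $\chi(1)$ is the smallest among the $2$-parts of the degrees of the irreducible complex characters in the $2$-block of $\chi$. (Two irreducible characters $\chi,\psi$ lie in the same $2$-block if, for a maximal ideal $M$ containing $2$ of the ring of all algebraic integers in $\mathbb{C}$, one has $|K|\chi(x_K)/\chi(1)\equiv|K|\psi(x_K)/\psi(1) \bmod M$ for every conjugacy class $K$ of $G$, where $x_K\in K$.) Let $n=|G|_{2'}$ be the largest odd divisor of $|G|$, and let $F=\mathbb{Q}_n(\chi)$ be the subfield of $\mathbb{C}$ generated by $e^{2\pi i/n}$ and the values of $\chi$. Then $\chi$ is afforded by an absolutely irreducible $F$-representation of $G$; in particular, the Schur index $m_F(\chi)$ of $\chi$ over $F$ is $1$. -/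

import Mathlib

universe u

namespace CharacterFields

/-- `χ : G → ℂ` is an irreducible complex character of `G`: the trace function of an irreducible
finite-dimensional complex representation. -/
def IsIrrChar {G : Type*} [Group G] (χ : G → ℂ) : Prop :=
  ∃ (d : ℕ) (ρ : Representation ℂ G (Fin d → ℂ)), ρ.IsIrreducible ∧ ρ.character = χ

/-- The degree of a character: the natural number `d` with `χ 1 = d`. -/
noncomputable def charDegree {G : Type*} [Group G] (χ : G → ℂ) : ℕ :=
  Function.invFun (Nat.cast : ℕ → ℂ) (χ 1)

theorem charDegree_character {G : Type*} [Group G] {d : ℕ}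
    (ρ : Representation ℂ G (Fin d → ℂ)) : charDegree ρ.character = d := by
  unfold charDegree
  rw [Representation.char_one]
  simpa using Function.leftInverse_invFun (Nat.cast_injective (R := ℂ)) d

/-- The central character `ω_χ`, evaluated at the sum of the conjugacy class `K` of `x`:
`ω_χ(K) = |K| χ(x) / χ(1)`. -/
noncomputable def centralChar {G : Type*} [Group G] (χ : G → ℂ) (x : G) : ℂ :=
  ((conjugatesOf x).ncard : ℂ) * χ x / χ 1

/-- The ring of all algebraic integers in `ℂ`. -/
abbrev AlgInt : Subalgebra ℤ ℂ := integralClosure ℤ ℂ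

/-- The set `Irr(B)` of the irreducible complex characters in the block `B` containing `χ`, with
respect to a maximal ideal `M` (lying over `p`) of the ring of algebraic integers: all irreducible
characters `ψ` with `ω_ψ(K) ≡ ω_χ(K) mod M` for every conjugacy class `K`. -/
def blockOf {G : Type*} [Group G] (M : Ideal AlgInt) (χ : G → ℂ) : Set (G → ℂ) :=
  {ψ | IsIrrChar ψ ∧ ∀ x : G, ∃ a ∈ M, (a : ℂ) = centralChar ψ x - centralChar χ x}

/-- The defect `d(B)` of a `p`-block `B`, given by its set of irreducible complex characters:
if `p ^ a` is the order of a Sylow `p`-subgroup of `G`, then `p ^ (a - d(B))` is the smallest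
`p`-part of the degree of a character in `B`. -/
noncomputable def blockDefect {G : Type*} [Group G] (p : ℕ) (B : Set (G → ℂ)) : ℤ :=
  (padicValNat p (Nat.card G) : ℤ) - (sInf ((fun ψ => padicValNat p (charDegree ψ)) '' B) : ℕ)

/-- The `p`-height `h` of an irreducible character `χ` in its `p`-block `B`:
the `p`-part of `χ(1)` is `p ^ (a - d(B) + h)`. -/
noncomputable def charHeight {G : Type*} [Group G] (p : ℕ) (M : Ideal AlgInt) (χ : G → ℂ) : ℤ :=
  (padicValNat p (charDegree χ) : ℤ) -
    ((padicValNat p (Nat.card G) : ℤ) - blockDefect p (blockOf M χ))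

/-- The field of values `ℚ(χ)`. -/
noncomputable def fieldOfValues {G : Type*} (χ : G → ℂ) : IntermediateField ℚ ℂ :=
  IntermediateField.adjoin ℚ (Set.range χ)

/-- The cyclotomic field `ℚ_n = ℚ(exp(2πi/n))`, for `n ≥ 1`. -/
noncomputable def cyclotomicSubfield (n : ℕ) : IntermediateField ℚ ℂ :=
  IntermediateField.adjoin ℚ {Complex.exp (2 * Real.pi * Complex.I / n)}

/-- The representation `ρ` of `G` over `K` affords the complex-valued function `χ`. -/
def Affords {G : Type*} [Group G] {K : IntermediateField ℚ ℂ} {d : ℕ}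
    (ρ : Representation K G (Fin d → K)) (χ : G → ℂ) : Prop :=
  ∀ g : G, ((ρ.character g : K) : ℂ) = χ g

/-- Extension of scalars of a representation. -/
noncomputable def scalarExt {k : Type*} [Field k] (K : Type*) [Field K] [Algebra k K] {G : Type*}
    [Group G] {V : Type*} [AddCommGroup V] [Module k V] (ρ : Representation k G V) :
    Representation K G (TensorProduct k K V) :=
  ((Module.End.baseChangeHom k K V : Module.End k V →ₐ[k] _) : Module.End k V →* _).comp ρ

/-- A representation over `k` is absolutely irreducible if it stays irreducible over every
extension field of `k`. (The algebraic closure of `k` is among the extensions considered.) -/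
def IsAbsolutelyIrreducible {k : Type u} [Field k] {G : Type*} [Group G] {V : Type*}
    [AddCommGroup V] [Module k V] (ρ : Representation k G V) : Prop :=
  ∀ (K : Type u) [Field K] [Algebra k K], (scalarExt K ρ).IsIrreducible

/-- The Schur index `m_F(χ)`: the least `m ≥ 1` such that the character `m χ` is afforded by a
representation over `F(χ)`. -/
noncomputable def schurIndex {G : Type*} [Group G] (F : IntermediateField ℚ ℂ) (χ : G → ℂ) : ℕ :=
  sInf {m : ℕ | 1 ≤ m ∧ ∃ (d : ℕ) (ρ : Representation ↥(F ⊔ fieldOfValues χ) G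
    (Fin d → ↥(F ⊔ fieldOfValues χ))), Affords ρ (fun g => (m : ℂ) * χ g)}

end CharacterFields

/-! Over a field k containing the values of χ, call a representation homogeneous if class sums act
on it by the central character of χ; its character is then a multiple of χ. The smallest positive
homogeneous dimension δ divides all the others, and χ is afforded over k as soon as δ divides χ(1).
If a linear character λ of a subgroup H takes values in k and has multiplicity m in the restriction
of χ to H, the left ideal k[G]·e_χ·ε_λ is homogeneous of dimension χ(1)m. So it suffices to find,
for each prime l, a homogeneous dimension χ(1)m with m prime to l (`exists_character_eq`).

For odd l, an argument in the style of Brauer induction gives some λ with multiplicity prime to l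
(`exists_multiplicity_not_dvd`). Its values lie in F(ζ) with ζ a root of unity of 2-power order; the
degree of F(ζ) over F is a power of 2, so restriction of scalars to F costs only a factor prime to
l. For l = 2 such a loss is not allowed, so H must have odd order, which puts the values of λ in
ℚ_n. Here height zero enters: `exists_regular_not_dvd` gives a 2-regular x with χ(x) not divisible
by 2, hence an odd multiplicity on a subgroup of ⟨x⟩.

That lemma holds for every prime p. If χ were divisible by p on all p-regular elements, subtract
from a multiple of χ a combination of section functions to get a class function D vanishing on
p-regular elements. Let p^h be the p-part of χ(1), and evaluate at z^q, with z central, killing the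
characters outside the block, and q a large power of p. Rotating words cyclically shows that p^(h+1)
divides D(z^q) (`exists_evalAt_pow_eq`). By height zero p^h divides φ(z^q) for every character φ, so
the section terms are divisible by p^(h+1) too, whereas the term of χ is not. -/

open Module

namespace CharacterFields

/-! ### Complements, characters and irreducibility over a field of characteristic zero. -/

section General

variable {k : Type*} [Field k] {G : Type*} [Group G] {V : Type*} [AddCommGroup V] [Module k V]

/-- The trace on the range of a commuting idempotent. -/
theorem character_toRepresentation [FiniteDimensional k V] (ρ : Representation k G V)
    (U : Subrepresentation ρ) (π : V →ₗ[k] V) (hπ : ∀ v ∈ U, π v = v) (hU : ∀ v, π v ∈ U) (g : G) :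
    U.toRepresentation.character g = LinearMap.trace k V (ρ g ∘ₗ π) := by
  rw [← LinearMap.trace_restrict_eq_of_forall_mem U.toSubmodule (ρ g ∘ₗ π)
    (fun x => U.apply_mem_toSubmodule g (hU x))]
  unfold Representation.character
  congr 1
  ext ⟨v, hv⟩
  simp only [LinearMap.restrict_apply, LinearMap.comp_apply]
  rw [hπ v hv]
  rfl

theorem finrank_toSubmodule_eq_trace [FiniteDimensional k V] (ρ : Representation k G V)
    (U : Subrepresentation ρ) (π : V →ₗ[k] V) (hπ : ∀ v ∈ U, π v = v) (hU : ∀ v, π v ∈ U) :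
    (finrank k U.toSubmodule : k) = LinearMap.trace k V π := by
  have := character_toRepresentation ρ U π hπ hU 1
  rw [Representation.char_one, map_one] at this
  exact this

/-- The subrepresentation cut out by a commuting endomorphism. -/
def rangeSubrep (ρ : Representation k G V) (π : V →ₗ[k] V) (h : ∀ g, ρ g ∘ₗ π = π ∘ₗ ρ g) :
    Subrepresentation ρ where
  toSubmodule := LinearMap.range π
  apply_mem_toSubmodule g v := by
    rintro ⟨w, rfl⟩
    exact ⟨ρ g w, (LinearMap.congr_fun (h g) w).symm⟩

theorem character_rangeSubrep [FiniteDimensional k V] (ρ : Representation k G V) (π : V →ₗ[k] V)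
    (h : ∀ g, ρ g ∘ₗ π = π ∘ₗ ρ g) (hπ : π ∘ₗ π = π) (g : G) :
    (rangeSubrep ρ π h).toRepresentation.character g = LinearMap.trace k V (ρ g ∘ₗ π) := by
  refine character_toRepresentation ρ _ π ?_ (fun v => LinearMap.mem_range_self π v) g
  rintro _ ⟨w, rfl⟩
  exact LinearMap.congr_fun hπ w

theorem exists_equivariant_projection [Finite G] [CharZero k] (ρ : Representation k G V)
    (U : Subrepresentation ρ) : ∃ π : V →ₗ[k] V, (∀ g, ρ g ∘ₗ π = π ∘ₗ ρ g) ∧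
      (∀ v ∈ U, π v = v) ∧ ∀ v, π v ∈ U := by
  have : NeZero (Nat.card G : k) := ⟨Nat.cast_ne_zero.2 Nat.card_pos.ne'⟩
  obtain ⟨U', hU⟩ := exists_isCompl U
  have hc : IsCompl U.toSubmodule U'.toSubmodule := by
    constructor
    · rw [disjoint_iff, ← Subrepresentation.toSubmodule_inf, hU.inf_eq_bot]; rfl
    · rw [codisjoint_iff, ← Subrepresentation.toSubmodule_sup, hU.sup_eq_top]; rfl
  refine ⟨U.toSubmodule.projection U'.toSubmodule hc, fun g => ?_, fun v hv => ?_, fun v => ?_⟩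
  · ext v
    obtain ⟨a, b, rfl⟩ : ∃ a : U.toSubmodule, ∃ b : U'.toSubmodule, (a : V) + b = v := by
      have : v ∈ U.toSubmodule ⊔ U'.toSubmodule := by rw [hc.sup_eq_top]; trivial
      obtain ⟨a, ha, b, hb, h⟩ := Submodule.mem_sup.1 this
      exact ⟨⟨a, ha⟩, ⟨b, hb⟩, h⟩
    have ha := U.apply_mem_toSubmodule g a.2
    have hb := U'.apply_mem_toSubmodule g b.2
    simp only [LinearMap.comp_apply, map_add]
    rw [Submodule.projection_apply_left, Submodule.projection_apply_right,
      Submodule.projection_apply_of_mem_left hc ha,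
      (Submodule.projection_apply_eq_zero_iff hc).2 hb, map_zero]
  · exact Submodule.projection_apply_of_mem_left hc hv
  · exact Submodule.projection_apply_mem hc v

theorem character_eq_add [Finite G] [CharZero k] [FiniteDimensional k V]
    (ρ : Representation k G V) (U : Subrepresentation ρ) :
    ∃ U' : Subrepresentation ρ,
      finrank k V = finrank k U.toSubmodule + finrank k U'.toSubmodule ∧
      (∀ g, ρ.character g =
        U.toRepresentation.character g + U'.toRepresentation.character g) := by
  obtain ⟨π, hc, h1, h2⟩ := exists_equivariant_projection ρ U
  have hc' : ∀ g, ρ g ∘ₗ (1 - π) = (1 - π) ∘ₗ ρ g := fun g => by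
    rw [LinearMap.comp_sub, hc, LinearMap.sub_comp]; rfl
  have hpp : π ∘ₗ π = π := by ext v; exact h1 _ (h2 v)
  have hpp' : (1 - π) ∘ₗ (1 - π) = 1 - π := by
    ext v
    have := LinearMap.congr_fun hpp v
    simp only [LinearMap.comp_apply] at this
    simp [this]
  have key : ∀ g, ρ.character g = U.toRepresentation.character g +
      (rangeSubrep ρ (1 - π) hc').toRepresentation.character g := fun g => by
    rw [character_rangeSubrep ρ _ hc' hpp', character_toRepresentation ρ U π h1 h2, ← map_add,
      LinearMap.comp_sub]
    unfold Representation.character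
    congr 1
    ext v; simp
  refine ⟨rangeSubrep ρ (1 - π) hc', ?_, key⟩
  have := key 1
  simp only [Representation.char_one] at this
  exact_mod_cast this

/-- Norm one makes the endomorphism ring one-dimensional, so an equivariant projection onto any
subrepresentation is a scalar. The field need not be algebraically closed, which is what absolute
irreducibility requires. -/
theorem isIrreducible_of_sum_eq_card [Fintype G] [CharZero k] [FiniteDimensional k V]
    (ρ : Representation k G V)
    (h : ∑ g, ρ.character g * ρ.character g⁻¹ = Nat.card G) : ρ.IsIrreducible := by
  have hne : NeZero (Nat.card G : k) := ⟨Nat.cast_ne_zero.2 Nat.card_pos.ne'⟩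
  let : Invertible (Nat.card G : k) := invertibleOfNonzero hne.1
  have h1 := Representation.card_inv_mul_sum_char_mul_char_eq_finrank ρ ρ
  rw [h, inv_mul_cancel₀ hne.1] at h1
  have h1 : finrank k (Representation.IntertwiningMap ρ ρ) = 1 := by exact_mod_cast h1.symm
  have hid : (Representation.IntertwiningMap.id ρ) ≠ 0 := by
    intro h0
    have : Subsingleton V := ⟨fun a b => by
      have ha : Representation.IntertwiningMap.id ρ a = 0 := by rw [h0]; rfl
      have hb : Representation.IntertwiningMap.id ρ b = 0 := by rw [h0]; rfl
      exact ha.trans hb.symm⟩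
    have : Subsingleton (Representation.IntertwiningMap ρ ρ) := ⟨fun a b => by
      ext v; exact Subsingleton.elim _ _⟩
    rw [finrank_zero_of_subsingleton] at h1
    exact absurd h1 (by norm_num)
  have : Nontrivial (Subrepresentation ρ) := by
    refine ⟨⊥, ⊤, fun h => hid ?_⟩
    ext v
    have : v ∈ (⊥ : Subrepresentation ρ) := by rw [h]; exact (trivial : v ∈ (⊤ : Submodule k V))
    exact this
  refine ⟨fun U => ?_⟩
  obtain ⟨π, hc, hp1, hp2⟩ := exists_equivariant_projection ρ U
  let f : Representation.IntertwiningMap ρ ρ := ⟨π, fun g => (hc g).symm⟩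
  obtain ⟨c, hcf⟩ := (finrank_eq_one_iff_of_nonzero' _ hid).1 h1 f
  have hf : ∀ v, π v = c • v := fun v => by
    have : f v = (c • Representation.IntertwiningMap.id ρ) v := by rw [hcf]
    exact this
  by_cases hU : ∀ v ∈ U, v = 0
  · left
    apply Subrepresentation.toSubmodule_injective
    exact (Submodule.eq_bot_iff _).2 hU
  · right
    push Not at hU
    obtain ⟨v, hv, hv0⟩ := hU
    have : c = 1 := by
      have h2 := hp1 v hv
      rw [hf] at h2
      by_contra hne
      apply hv0
      have : (c - 1) • v = 0 := by rw [sub_smul, h2, one_smul, sub_self]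
      exact (smul_eq_zero.1 this).resolve_left (sub_ne_zero.2 hne)
    apply Subrepresentation.toSubmodule_injective
    refine (Submodule.eq_top_iff'.2 fun w => ?_)
    have := hp2 w
    rw [hf, ‹c = 1›, one_smul] at this
    exact this

theorem sum_character_of_isIrreducible [Fintype G] [CharZero k] [IsAlgClosed k]
    [FiniteDimensional k V] (ρ : Representation k G V) (h : ρ.IsIrreducible) :
    ∑ g, ρ.character g * ρ.character g⁻¹ = Nat.card G := by
  have hne : (Nat.card G : k) ≠ 0 := Nat.cast_ne_zero.2 Nat.card_pos.ne'
  let : Invertible (Nat.card G : k) := invertibleOfNonzero hne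
  have h1 := Representation.char_orthonormal ρ ρ
  rw [if_pos ⟨Representation.Equiv.refl ρ⟩, inv_mul_eq_one₀ hne] at h1
  exact h1.symm

/-- Transport of a representation to coordinate space. -/
theorem exists_fin_rep [FiniteDimensional k V] (ρ : Representation k G V) :
    ∃ ρ' : Representation k G (Fin (finrank k V) → k), ρ'.character = ρ.character := by
  let e := (finBasis k V).equivFun
  refine ⟨(e.conjRingEquiv : End k V →* End k (Fin (finrank k V) → k)).comp ρ, ?_⟩
  funext g
  exact LinearMap.trace_conj' (ρ g) e

end General

/-! ### Complex characters: complete reducibility and integrality of values. -/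

section Complex

variable {G : Type*} [Group G]

/-- `φ` is the character of a finite-dimensional complex representation. -/
def IsChar (φ : G → ℂ) : Prop :=
  ∃ (d : ℕ) (ρ : Representation ℂ G (Fin d → ℂ)), ρ.character = φ

theorem isChar_character {V : Type*} [AddCommGroup V] [Module ℂ V] [FiniteDimensional ℂ V]
    (ρ : Representation ℂ G V) : IsChar ρ.character := by
  obtain ⟨ρ', h⟩ := exists_fin_rep ρ
  exact ⟨_, ρ', h⟩

theorem isIrrChar_character [Finite G] {V : Type*} [AddCommGroup V] [Module ℂ V]
    [FiniteDimensional ℂ V] (ρ : Representation ℂ G V) (hρ : ρ.IsIrreducible) :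
    IsIrrChar ρ.character := by
  have := Fintype.ofFinite G
  obtain ⟨ρ', h⟩ := exists_fin_rep ρ
  exact ⟨_, ρ', isIrreducible_of_sum_eq_card _ (by
    rw [h]; exact sum_character_of_isIrreducible ρ hρ), h⟩

theorem IsIrrChar.isChar {χ : G → ℂ} (h : IsIrrChar χ) : IsChar χ := by
  obtain ⟨d, ρ, -, rfl⟩ := h
  exact ⟨d, ρ, rfl⟩

theorem exists_multiset_irrChar_aux [Finite G] (n : ℕ) :
    ∀ (V : Type) [AddCommGroup V] [Module ℂ V] [FiniteDimensional ℂ V]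
      (ρ : Representation ℂ G V), finrank ℂ V = n →
      ∃ s : Multiset (G → ℂ), (∀ ψ ∈ s, IsIrrChar ψ) ∧ ρ.character = s.sum := by
  induction n using Nat.strong_induction_on with
  | _ n ih =>
    intro V _ _ _ ρ hn
    by_cases hirr : ρ.IsIrreducible
    · exact ⟨{ρ.character}, by simpa using isIrrChar_character ρ hirr, by simp⟩
    by_cases h0 : ∃ U : Subrepresentation ρ, U ≠ ⊥ ∧ U ≠ ⊤
    · obtain ⟨U, hb, ht⟩ := h0
      obtain ⟨U', hd, hc⟩ := character_eq_add ρ U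
      have h1 : finrank ℂ U.toSubmodule ≠ 0 := fun h => hb
        (Subrepresentation.toSubmodule_injective (Submodule.finrank_eq_zero.1 h))
      have h2 : finrank ℂ U.toSubmodule ≠ finrank ℂ V := fun h => ht
        (Subrepresentation.toSubmodule_injective (Submodule.eq_top_of_finrank_eq h))
      obtain ⟨s, hs, hs'⟩ := ih _ (by omega) _ U.toRepresentation rfl
      obtain ⟨t, ht, ht'⟩ := ih _ (by omega) _ U'.toRepresentation rfl
      refine ⟨s + t, fun ψ hψ => (Multiset.mem_add.1 hψ).elim (hs ψ) (ht ψ), ?_⟩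
      rw [Multiset.sum_add, ← hs', ← ht']
      funext g
      exact hc g
    · push Not at h0
      have : ¬ Nontrivial (Subrepresentation ρ) := fun _ => hirr ⟨fun U => by
        by_cases h : U = ⊥
        · exact Or.inl h
        · exact Or.inr (h0 U h)⟩
      have hbt : (⊥ : Subrepresentation ρ) = ⊤ := by
        by_contra h
        exact this ⟨_, _, h⟩
      have : Subsingleton V := by
        have h1 : (⊥ : Submodule ℂ V) = ⊤ := congrArg Subrepresentation.toSubmodule hbt
        exact (Submodule.subsingleton_iff ℂ).1 (subsingleton_of_bot_eq_top h1)
      refine ⟨0, by simp, ?_⟩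
      funext g
      have : ρ g = 0 := by ext v; exact Subsingleton.elim _ _
      simp [Representation.character, this]

/-- Complete reducibility: a character is a sum of irreducible characters. -/
theorem IsChar.exists_multiset [Finite G] {φ : G → ℂ} (h : IsChar φ) :
    ∃ s : Multiset (G → ℂ), (∀ ψ ∈ s, IsIrrChar ψ) ∧ φ = s.sum := by
  obtain ⟨d, ρ, rfl⟩ := h
  exact exists_multiset_irrChar_aux _ _ ρ rfl

theorem isIntegral_trace_of_pow_eq_one {V : Type*} [AddCommGroup V] [Module ℂ V]
    [FiniteDimensional ℂ V] (f : End ℂ V) {n : ℕ} (hn : 0 < n) (hf : f ^ n = 1) :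
    LinearMap.trace ℂ V f ∈ AlgInt := by
  rw [Module.End.trace_eq_sum_roots_charpoly_of_splits (IsAlgClosed.splits _)]
  refine multiset_sum_mem _ fun x hx => ?_
  have hx' : f.HasEigenvalue x := (Module.End.hasEigenvalue_iff_isRoot_charpoly f x).2
    (Polynomial.isRoot_of_mem_roots hx)
  obtain ⟨v, hv⟩ := hx'.exists_hasEigenvector
  have h1 : x ^ n = 1 := by
    have := hv.pow_apply n
    rw [hf] at this
    have h2 : (x ^ n - 1) • v = 0 := by
      rw [sub_smul, ← this]; simp
    exact sub_eq_zero.1 ((smul_eq_zero.1 h2).resolve_right hv.2)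
  exact IsIntegral.of_pow hn (by rw [h1]; exact isIntegral_one)

theorem IsChar.mem_algInt [Finite G] {φ : G → ℂ} (h : IsChar φ) (g : G) : φ g ∈ AlgInt := by
  obtain ⟨d, ρ, rfl⟩ := h
  exact isIntegral_trace_of_pow_eq_one (ρ g) (Nat.card_pos (α := G))
    (by rw [← map_pow, pow_card_eq_one', map_one])

end Complex

end CharacterFields

namespace CharacterFields

/-! ### Generalized characters with algebraic integer coefficients, and section functions. -/

section CharSpan

theorem trace_funLeft {k X : Type*} [Field k] [Fintype X] [DecidableEq X] (f : X → X) :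
    LinearMap.trace k (X → k) (LinearMap.funLeft k k f) =
      ((Finset.univ.filter fun x => f x = x).card : k) := by
  rw [LinearMap.trace_eq_matrix_trace k (Pi.basisFun k X), Matrix.trace]
  simp [LinearMap.funLeft_apply, Pi.single_apply]

theorem exists_smul_one_of_commute {k G V : Type*} [Field k] [IsAlgClosed k] [Group G]
    [AddCommGroup V] [Module k V] [FiniteDimensional k V] (ρ : Representation k G V)
    [ρ.IsIrreducible] (f : End k V) (hf : ∀ g, ρ g * f = f * ρ g) : ∃ c : k, f = c • 1 := by
  let F : Representation.IntertwiningMap ρ ρ := ⟨f, fun g => (hf g).symm⟩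
  obtain ⟨c, hc⟩ : ∃ c, algebraMap k (Representation.IntertwiningMap ρ ρ) c = F :=
    Representation.IsIrreducible.algebraMap_intertwiningMap_bijective_of_isAlgClosed.2 F
  refine ⟨c, LinearMap.ext fun v => ?_⟩
  have : (algebraMap k (Representation.IntertwiningMap ρ ρ) c) v = F v := by rw [hc]
  exact this.symm

variable {G : Type*} [Group G]

open scoped Classical in
theorem IsIrrChar.sum_mul [Fintype G] {χ ψ : G → ℂ} (hχ : IsIrrChar χ) (hψ : IsIrrChar ψ) :
    ∑ g, χ g * ψ g⁻¹ = if χ = ψ then (Nat.card G : ℂ) else 0 := by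
  obtain ⟨d, ρ, hρ, rfl⟩ := hχ
  obtain ⟨e, σ, hσ, rfl⟩ := hψ
  split_ifs with h
  · rw [← h]; exact sum_character_of_isIrreducible ρ hρ
  · have hne : (Nat.card G : ℂ) ≠ 0 := Nat.cast_ne_zero.2 Nat.card_pos.ne'
    let _ : Invertible (Nat.card G : ℂ) := invertibleOfNonzero hne
    have h1 := Representation.char_orthonormal ρ σ
    rw [if_neg fun ⟨e⟩ => h (Representation.char_iso e).symm] at h1
    exact (mul_eq_zero.1 h1).resolve_left (inv_ne_zero hne)

theorem IsIrrChar.one_ne_zero {χ : G → ℂ} (h : IsIrrChar χ) : χ 1 ≠ 0 := by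
  obtain ⟨d, ρ, hρ, rfl⟩ := h
  rw [Representation.char_one]
  intro h0
  have h0 : finrank ℂ (Fin d → ℂ) = 0 := by exact_mod_cast h0
  have := finrank_zero_iff.1 h0
  obtain ⟨a, b, hab⟩ := (hρ.toNontrivial).exists_pair_ne
  exact hab (Subrepresentation.toSubmodule_injective (Subsingleton.elim _ _))

theorem IsChar.comp {H : Type*} [Group H] {φ : G → ℂ} (h : IsChar φ) (f : H →* G) :
    IsChar fun x => φ (f x) := by
  obtain ⟨d, ρ, rfl⟩ := h
  exact ⟨d, ρ.comp f, rfl⟩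

theorem IsChar.inv {φ : G → ℂ} (h : IsChar φ) : IsChar fun x => φ x⁻¹ := by
  obtain ⟨d, ρ, rfl⟩ := h
  convert isChar_character ρ.dual using 1
  funext x
  rw [Representation.char_dual]

theorem IsChar.mul {φ ψ : G → ℂ} (h : IsChar φ) (h' : IsChar ψ) : IsChar (φ * ψ) := by
  obtain ⟨d, ρ, rfl⟩ := h
  obtain ⟨e, σ, rfl⟩ := h'
  rw [← Representation.char_tensor]
  exact isChar_character _

theorem IsChar.conj {φ : G → ℂ} (h : IsChar φ) (t g : G) : φ (t * g * t⁻¹) = φ g := by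
  obtain ⟨d, ρ, rfl⟩ := h
  exact Representation.char_conj ρ g t

theorem isChar_one : IsChar (1 : G → ℂ) := by
  convert isChar_character (Representation.trivial ℂ G ℂ) using 1
  funext g
  simp only [Representation.character]
  rw [show Representation.trivial ℂ G ℂ g = 1 from rfl]
  simp

/-- Averaging a character over cosets of a normal subgroup gives a character. -/
theorem IsChar.average [Finite G] {φ : G → ℂ} (h : IsChar φ) (P : Subgroup G) [P.Normal]
    [Fintype P] : IsChar fun g => (Fintype.card P : ℂ)⁻¹ * ∑ u : P, φ (g * (u : G)) := by
  obtain ⟨d, ρ, rfl⟩ := h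
  have hne : (Fintype.card P : ℂ) ≠ 0 := Nat.cast_ne_zero.2 Fintype.card_ne_zero
  -- The projection onto the vectors fixed by P; it commutes with G because P is normal, so the
  -- average is the character of its range.
  let π : End ℂ (Fin d → ℂ) := (Fintype.card P : ℂ)⁻¹ • ∑ u : P, ρ u
  have hc : ∀ g, ρ g ∘ₗ π = π ∘ₗ ρ g := fun g => by
    change ρ g * π = π * ρ g
    simp only [π, mul_smul_comm, smul_mul_assoc, Finset.mul_sum, Finset.sum_mul, ← map_mul]
    congr 1
    refine Fintype.sum_equiv (MulAut.conjNormal g).toEquiv _ _ fun u => ?_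
    simp
  have hu : ∀ u : P, ρ u * π = π := fun u => by
    simp only [π, mul_smul_comm, Finset.mul_sum, ← map_mul]
    congr 1
    exact Fintype.sum_equiv (Equiv.mulLeft u) _ _ fun v => by simp
  have hp : π ∘ₗ π = π := by
    change π * π = π
    conv_lhs => enter [1]; rw [show π = (Fintype.card P : ℂ)⁻¹ • ∑ u : P, ρ u from rfl]
    rw [smul_mul_assoc, Finset.sum_mul, Finset.sum_congr rfl fun u _ => hu u, Finset.sum_const,
      Finset.card_univ, ← Nat.cast_smul_eq_nsmul ℂ, smul_smul, inv_mul_cancel₀ hne, one_smul]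
  convert isChar_character (rangeSubrep ρ π hc).toRepresentation using 1
  funext g
  rw [character_rangeSubrep ρ π hc hp]
  change _ = LinearMap.trace ℂ _ (ρ g * π)
  simp only [π, mul_smul_comm, Finset.mul_sum, ← map_mul, map_smul, map_sum, smul_eq_mul]
  rfl

/-- The span of the characters of `G` over the ring of algebraic integers. -/
noncomputable def charSpan (G : Type*) [Group G] : Submodule AlgInt (G → ℂ) :=
  Submodule.span AlgInt {φ | IsChar φ}

theorem IsChar.mem_charSpan {φ : G → ℂ} (h : IsChar φ) : φ ∈ charSpan G :=
  Submodule.subset_span h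

theorem smul_mem_charSpan {φ : G → ℂ} (h : φ ∈ charSpan G) {a : ℂ} (ha : a ∈ AlgInt) :
    a • φ ∈ charSpan G :=
  (charSpan G).smul_mem ⟨a, ha⟩ h

theorem one_mem_charSpan : (1 : G → ℂ) ∈ charSpan G := isChar_one.mem_charSpan

theorem charSpan_induction {p : (G → ℂ) → Prop} (h : ∀ φ, IsChar φ → p φ) (h0 : p 0)
    (hadd : ∀ φ ψ, p φ → p ψ → p (φ + ψ)) (hsmul : ∀ a ∈ AlgInt, ∀ φ, p φ → p (a • φ))
    {φ : G → ℂ} (hφ : φ ∈ charSpan G) : p φ := by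
  refine Submodule.span_induction (p := fun φ _ => p φ) (fun φ hφ => h φ hφ) h0
    (fun φ ψ _ _ => hadd φ ψ) (fun a φ _ => hsmul a.1 a.2 φ) hφ

theorem apply_mem_algInt [Finite G] {φ : G → ℂ} (hφ : φ ∈ charSpan G) (g : G) : φ g ∈ AlgInt := by
  refine charSpan_induction (p := fun φ => φ g ∈ AlgInt) (fun φ h => h.mem_algInt g)
    (zero_mem _) (fun φ ψ h h' => add_mem h h') (fun a ha φ h => mul_mem ha h) hφ

theorem mul_mem_charSpan {φ ψ : G → ℂ} (hφ : φ ∈ charSpan G) (hψ : ψ ∈ charSpan G) :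
    φ * ψ ∈ charSpan G := by
  refine charSpan_induction (p := fun φ => φ * ψ ∈ charSpan G) (fun φ h => ?_)
    (by rw [zero_mul]; exact zero_mem _) (fun φ φ' h h' => by rw [add_mul]; exact add_mem h h')
    (fun a ha φ h => by rw [smul_mul_assoc]; exact smul_mem_charSpan h ha) hφ
  refine charSpan_induction (p := fun ψ => φ * ψ ∈ charSpan G)
    (fun ψ h' => (h.mul h').mem_charSpan)
    (by rw [mul_zero]; exact zero_mem _) (fun φ φ' h h' => by rw [mul_add]; exact add_mem h h')
    (fun a ha φ h => by rw [mul_smul_comm]; exact smul_mem_charSpan h ha) hψ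

theorem comp_mem_charSpan {H : Type*} [Group H] {φ : G → ℂ} (hφ : φ ∈ charSpan G) (f : H →* G) :
    (fun x => φ (f x)) ∈ charSpan H := by
  refine charSpan_induction (p := fun φ => (fun x => φ (f x)) ∈ charSpan H)
    (fun φ h => (h.comp f).mem_charSpan) (zero_mem _) (fun φ ψ h h' => add_mem h h')
    (fun a ha φ h => smul_mem_charSpan h ha) hφ

theorem conj_of_mem_charSpan {φ : G → ℂ} (hφ : φ ∈ charSpan G) (t g : G) :
    φ (t * g * t⁻¹) = φ g := by
  refine charSpan_induction (p := fun φ => φ (t * g * t⁻¹) = φ g)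
    (fun φ h => h.conj t g) rfl (fun φ ψ h h' => by simp only [Pi.add_apply, h, h'])
    (fun a ha φ h => by simp only [Pi.smul_apply, h]) hφ

theorem average_mem_charSpan [Finite G] {φ : G → ℂ} (hφ : φ ∈ charSpan G) (P : Subgroup G)
    [P.Normal] [Fintype P] :
    (fun g => (Fintype.card P : ℂ)⁻¹ * ∑ u : P, φ (g * (u : G))) ∈ charSpan G := by
  refine charSpan_induction
    (p := fun φ => (fun g => (Fintype.card P : ℂ)⁻¹ * ∑ u : P, φ (g * (u : G))) ∈ charSpan G)
    (fun φ h => (h.average P).mem_charSpan) (by simp; exact zero_mem _)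
    (fun φ ψ h h' => ?_) (fun a ha φ h => ?_) hφ
  · convert add_mem h h' using 1
    funext g
    simp [Finset.sum_add_distrib, mul_add]
  · convert smul_mem_charSpan h ha using 1
    funext g
    simp only [Pi.smul_apply, smul_eq_mul, ← Finset.mul_sum]
    ring

theorem IsIrrChar.mul_center [Finite G] {χ : G → ℂ} (h : IsIrrChar χ) {c : G}
    (hc : c ∈ Subgroup.center G) : ∃ a ∈ AlgInt, ∀ g, χ (g * c) = a * χ g := by
  obtain ⟨d, ρ, hρ, rfl⟩ := h
  have h1 := IsIrrChar.one_ne_zero ⟨d, ρ, hρ, rfl⟩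
  obtain ⟨a, ha⟩ := exists_smul_one_of_commute ρ (ρ c) fun g => by
    rw [← map_mul, ← map_mul, Subgroup.mem_center_iff.1 hc g]
  have key : ∀ g, ρ.character (g * c) = a * ρ.character g := fun g => by
    simp [Representation.character, ha]
  refine ⟨a, ?_, key⟩
  refine IsIntegral.of_pow (Nat.card_pos (α := G)) ?_
  have h2 : ∀ n : ℕ, ρ.character (c ^ n) = a ^ n * ρ.character 1 := fun n => by
    induction n with
    | zero => simp
    | succ n ih => rw [pow_succ, key, ih, pow_succ]; ring
  have h3 := h2 (Nat.card G)
  rw [pow_card_eq_one'] at h3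
  have : a ^ Nat.card G = 1 := mul_right_cancel₀ h1 (by rw [← h3, one_mul])
  rw [this]
  exact isIntegral_one

/-- A central element acts on each irreducible constituent by a root of unity. This is why
coefficients are taken in `AlgInt` and not in ℤ. -/
theorem mul_center_mem_charSpan [Finite G] {φ : G → ℂ} (hφ : φ ∈ charSpan G) {c : G}
    (hc : c ∈ Subgroup.center G) : (fun g => φ (g * c)) ∈ charSpan G := by
  refine charSpan_induction (p := fun φ => (fun g => φ (g * c)) ∈ charSpan G)
    (fun φ h => ?_) (zero_mem _) (fun φ ψ h h' => add_mem h h')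
    (fun a ha φ h => smul_mem_charSpan h ha) hφ
  obtain ⟨s, hs, rfl⟩ := h.exists_multiset
  clear h
  induction s using Multiset.induction_on with
  | empty => exact zero_mem _
  | cons ψ s ih =>
    rw [Multiset.sum_cons]
    refine add_mem (a := fun g => ψ (g * c)) (b := fun g => s.sum (g * c)) ?_
      (ih fun ψ h => hs ψ (Multiset.mem_cons_of_mem h))
    obtain ⟨a, ha, h⟩ := (hs ψ (Multiset.mem_cons_self ψ s)).mul_center hc
    convert smul_mem_charSpan (hs ψ (Multiset.mem_cons_self ψ s)).isChar.mem_charSpan ha using 1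
    funext g
    exact h g

open scoped Classical in
/-- The number of cosets `tP` with `t⁻¹ g t ∈ x P`, for `x` commuting with `P`. -/
noncomputable def sectionFun [Fintype G] (x : G) (P : Subgroup G) (g : G) : ℂ :=
  (Nat.card P : ℂ)⁻¹ * ((Finset.univ.filter fun t : G => x⁻¹ * (t⁻¹ * g * t) ∈ P).card : ℂ)

/-- With E = ⟨x⟩P, let G × E permute the set G by left and right multiplication. Average the
permutation character over 1 × P, translate by (1, x), which is central since E centralizes x, and
restrict to G: a point t is fixed by (g, xu) exactly when t⁻¹gt = xu. -/
theorem sectionFun_mem_charSpan [Fintype G] (x : G) (P : Subgroup G)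
    (hx : ∀ u ∈ P, x * u = u * x) : sectionFun x P ∈ charSpan G := by
  classical
  let E : Subgroup G := Subgroup.zpowers x ⊔ P
  have hxE : x ∈ E := Subgroup.mem_sup_left (Subgroup.mem_zpowers x)
  have hPE : P ≤ E := le_sup_right
  have hEx : E ≤ Subgroup.centralizer {x} := by
    refine sup_le ?_ ?_
    · rw [Subgroup.zpowers_le, Subgroup.mem_centralizer_singleton_iff]
    · intro u hu
      rw [Subgroup.mem_centralizer_singleton_iff]
      exact (hx u hu).symm
  have hEP : E ≤ Subgroup.normalizer (P : Set G) := by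
    refine sup_le ?_ Subgroup.le_normalizer
    rw [Subgroup.zpowers_le, Subgroup.mem_normalizer_iff]
    intro u
    constructor
    · intro hu
      rw [hx u hu, mul_inv_cancel_right]
      exact hu
    · intro hu
      have := hx _ hu
      rw [inv_mul_cancel_right] at this
      rwa [mul_left_cancel this] at hu
  let P' : Subgroup (G × E) := (⊥ : Subgroup G).prod (P.subgroupOf E)
  have hPn : (P.subgroupOf E).Normal := Subgroup.normal_subgroupOf_of_le_normalizer hEP
  have hP'n : P'.Normal := Subgroup.prod_normal _ _
  let ρ : Representation ℂ (G × E) (G → ℂ) :=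
    { toFun := fun p => LinearMap.funLeft ℂ ℂ fun t => p.1⁻¹ * t * p.2
      map_one' := by ext; simp [LinearMap.funLeft_apply]
      map_mul' := fun p q => by
        ext i t
        simp [LinearMap.funLeft_apply, mul_assoc] }
  have h1 := ((isChar_character ρ).average P').mem_charSpan
  have hc : ((1, ⟨x, hxE⟩) : G × E) ∈ Subgroup.center (G × E) := by
    rw [Subgroup.mem_center_iff]
    rintro ⟨g, e, he⟩
    ext
    · simp
    · exact Subgroup.mem_centralizer_singleton_iff.1 (hEx he)
  have h2 := comp_mem_charSpan (mul_center_mem_charSpan h1 hc) (MonoidHom.inl G E)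
  convert h2 using 1
  funext g
  let e : P ≃ P' :=
    { toFun := fun u => ⟨(1, ⟨u, hPE u.2⟩), by
        rw [Subgroup.mem_prod]; exact ⟨rfl, u.2⟩⟩
      invFun := fun p => ⟨p.1.2, (Subgroup.mem_prod.1 p.2).2⟩
      left_inv := fun u => rfl
      right_inv := fun p => by
        ext
        · exact (Subgroup.mem_bot.1 (Subgroup.mem_prod.1 p.2).1).symm
        · rfl }
  have hcard : Nat.card P = Fintype.card P' := by
    rw [← Nat.card_eq_fintype_card]; exact Nat.card_congr e
  rw [sectionFun, hcard, ← e.sum_comp]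
  congr 1
  have hρ : ∀ u : P, ρ.character (MonoidHom.inl G E g * (1, ⟨x, hxE⟩) * (e u : G × E)) =
      ((Finset.univ.filter fun t : G => x⁻¹ * (t⁻¹ * g * t) = u).card : ℂ) := fun u => by
    refine (trace_funLeft _).trans ?_
    congr 2
    ext t
    simp only [Finset.mem_filter, Finset.mem_univ, true_and]
    simp only [e, MonoidHom.inl_apply, Prod.mk_mul_mk, Equiv.coe_fn_mk, mul_one, one_mul,
      Subgroup.coe_mul]
    rw [inv_mul_eq_iff_eq_mul, mul_assoc, inv_mul_eq_iff_eq_mul, mul_assoc, inv_mul_eq_iff_eq_mul]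
    exact eq_comm
  rw [Finset.sum_congr rfl fun u _ => hρ u, ← Nat.cast_sum]
  congr 1
  rw [Finset.card_eq_sum_card_fiberwise (f := fun t => x⁻¹ * (t⁻¹ * g * t))
    (t := Finset.univ.filter (· ∈ P)) (fun t ht => by simpa using ht)]
  rw [Finset.sum_subtype (p := (· ∈ P)) _ (by simp)]
  refine Finset.sum_congr rfl fun u _ => ?_
  congr 1
  ext t
  simp only [Finset.mem_filter, Finset.mem_univ, true_and, and_iff_right_iff_imp]
  intro h
  rw [h]
  exact u.2

end CharSpan

end CharacterFields

namespace CharacterFields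

/-! ### Evaluating functions on the group algebra. -/

section Eval

variable {k G : Type*} [Field k] [Fintype G]

/-- Linear extension of a function on `G` to the group algebra. -/
noncomputable def evalAt (φ : G → k) : MonoidAlgebra k G →ₗ[k] k where
  toFun z := ∑ g, z.coeff g * φ g
  map_add' x y := by simp [add_mul, Finset.sum_add_distrib]
  map_smul' c x := by simp [Finset.mul_sum, mul_assoc]

theorem evalAt_apply (φ : G → k) (z : MonoidAlgebra k G) :
    evalAt φ z = ∑ g, z.coeff g * φ g := rfl

@[simp] theorem evalAt_single (φ : G → k) (g : G) (r : k) :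
    evalAt φ (MonoidAlgebra.single g r) = r * φ g := by
  classical
  rw [evalAt_apply, Finset.sum_eq_single g]
  · simp
  · intro h _ hne
    simp [MonoidAlgebra.coeff_single, hne.symm]
  · simp

theorem sum_single_coeff (z : MonoidAlgebra k G) :
    z = ∑ g, MonoidAlgebra.single g (z.coeff g) := by
  classical
  induction z using MonoidAlgebra.induction_linear with
  | zero => simp
  | add x y hx hy =>
    conv_lhs => rw [hx, hy]
    simp [MonoidAlgebra.single_add, Finset.sum_add_distrib]
  | single g r =>
    rw [Finset.sum_eq_single g]
    · simp
    · intro h _ hne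
      simp [MonoidAlgebra.coeff_single, hne.symm]
    · simp

variable [Group G]

theorem evalAt_mul (φ : G → k) (z w : MonoidAlgebra k G) :
    evalAt φ (z * w) = ∑ g, z.coeff g * evalAt (fun h => φ (g * h)) w := by
  conv_lhs => rw [sum_single_coeff z, Finset.sum_mul, map_sum]
  refine Finset.sum_congr rfl fun g _ => ?_
  induction w using MonoidAlgebra.induction_linear with
  | zero => simp
  | add x y hx hy => rw [mul_add, map_add, map_add, hx, hy, mul_add]
  | single h r =>
    rw [MonoidAlgebra.single_mul_single, evalAt_single, evalAt_single, mul_assoc]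

theorem evalAt_character {V : Type*} [AddCommGroup V] [Module k V] (ρ : Representation k G V)
    (z : MonoidAlgebra k G) :
    evalAt ρ.character z = LinearMap.trace k V (ρ.asAlgebraHom z) := by
  induction z using MonoidAlgebra.induction_linear with
  | zero => simp
  | add x y hx hy => rw [map_add, map_add, map_add, hx, hy]
  | single g r =>
    rw [evalAt_single, Representation.asAlgebraHom_single, map_smul, smul_eq_mul]
    rfl

/-- The expansion over words of length n is what a cyclic group of rotations can act on. -/
theorem evalAt_pow (φ : G → k) (z : MonoidAlgebra k G) (n : ℕ) :
    evalAt φ (z ^ n) =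
      ∑ u : Fin n → G, (∏ i, z.coeff (u i)) * φ (List.ofFn u).prod := by
  induction n generalizing φ with
  | zero => simp [MonoidAlgebra.one_def]
  | succ n ih =>
    rw [pow_succ', evalAt_mul]
    simp_rw [ih]
    rw [← (Fin.consEquiv fun _ : Fin (n + 1) => G).sum_comp, Fintype.sum_prod_type]
    refine Finset.sum_congr rfl fun g _ => ?_
    rw [Finset.mul_sum]
    refine Finset.sum_congr rfl fun u _ => ?_
    simp [Fin.consEquiv, Fin.prod_univ_succ, List.ofFn_succ, mul_assoc]

end Eval

/-! ### Cyclic rotation of words and divisibility by powers of p. -/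

section Rotation

open MulAction in
/-- Sums of invariant functions over a `p`-group action with large orbits on the support. -/
theorem exists_sum_eq_mul_of_orbit {A X : Type*} [Group A] [Fintype X] [MulAction A X]
    (R : Subring ℂ) (Φ : X → ℂ) (hΦ : ∀ x, Φ x ∈ R)
    (hinv : ∀ (a : A) x, Φ (a • x) = Φ x) (m : ℕ)
    (hm : ∀ x, Φ x ≠ 0 → m ∣ Nat.card (orbit A x)) : ∃ y ∈ R, ∑ x, Φ x = m * y := by
  classical
  rw [← Finset.sum_fiberwise Finset.univ (Quotient.mk (orbitRel A X)) Φ]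
  have key : ∀ ω : Quotient (orbitRel A X), ∃ y ∈ R,
      ∑ x ∈ Finset.univ.filter (fun x => Quotient.mk (orbitRel A X) x = ω), Φ x = m * y := by
    intro ω
    induction ω using Quotient.inductionOn with
    | _ x =>
    have hf : ∀ y ∈ Finset.univ.filter
        (fun y => Quotient.mk (orbitRel A X) y = Quotient.mk (orbitRel A X) x), Φ y = Φ x := by
      intro y hy
      rw [Finset.mem_filter] at hy
      obtain ⟨a, rfl⟩ := Quotient.exact hy.2
      exact hinv a x
    rw [Finset.sum_congr rfl hf, Finset.sum_const]
    by_cases h0 : Φ x = 0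
    · exact ⟨0, R.zero_mem, by simp [h0]⟩
    have hcard : (Finset.univ.filter
        (fun y => Quotient.mk (orbitRel A X) y = Quotient.mk (orbitRel A X) x)).card =
        Nat.card (orbit A x) := by
      rw [Nat.card_eq_fintype_card]
      refine (Fintype.card_of_subtype _ fun y => ?_).symm
      rw [Finset.mem_filter, Quotient.eq]
      exact ⟨fun h => h.2, fun h => ⟨Finset.mem_univ _, h⟩⟩
    rw [hcard]
    obtain ⟨j, hj⟩ := hm x h0
    refine ⟨j * Φ x, R.mul_mem (natCast_mem R j) (hΦ x), ?_⟩
    rw [hj, nsmul_eq_mul]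
    push_cast
    ring
  choose y hy hy' using key
  exact ⟨∑ ω, y ω, R.sum_mem fun ω _ => hy ω, by
    rw [Finset.mul_sum]; exact Finset.sum_congr rfl fun ω _ => hy' ω⟩

variable {G : Type*} [Group G]

/-- The product of a periodic word, indexed by the powers of `γ`. -/
def wordProd {A : Type*} [Group A] (γ : A) (n : ℕ) (u : A → G) : G :=
  ((List.range n).map fun i => u (γ ^ i)).prod

theorem wordProd_succ {A : Type*} [Group A] (γ : A) (n : ℕ) (u : A → G) :
    wordProd γ (n + 1) u = wordProd γ n u * u (γ ^ n) := by
  simp [wordProd, List.prod_range_succ]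

theorem wordProd_succ' {A : Type*} [Group A] (γ : A) (n : ℕ) (u : A → G) :
    wordProd γ (n + 1) u = u 1 * wordProd γ n (fun a => u (γ * a)) := by
  simp [wordProd, List.prod_range_succ', pow_succ']

theorem wordProd_add {A : Type*} [Group A] (γ : A) (m n : ℕ) (u : A → G) :
    wordProd γ (m + n) u = wordProd γ m u * wordProd γ n (fun a => u (γ ^ m * a)) := by
  induction n with
  | zero => simp [wordProd]
  | succ n ih => rw [← add_assoc, wordProd_succ, ih, wordProd_succ, mul_assoc, pow_add]

theorem wordProd_mul {A : Type*} [Group A] (γ : A) (m n : ℕ) (u : A → G)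
    (hu : ∀ a, u (γ ^ m * a) = u a) : wordProd γ (m * n) u = wordProd γ m u ^ n := by
  induction n with
  | zero => simp [wordProd]
  | succ n ih => rw [mul_add_one, add_comm, wordProd_add, funext hu, ih, pow_succ']

/-- A class function vanishing on the `p`-regular elements is highly divisible by `p` on
`p`-power powers. -/
theorem exists_evalAt_pow_eq [Fintype G] {p : ℕ} [Fact p.Prime] {e r : ℕ} {n' : ℕ}
    (hG : Nat.card G = p ^ e * n') (hn' : p.Coprime n') (R : Subring ℂ) (D : G → ℂ)
    (hD : ∀ g, D g ∈ R)
    (hconj : ∀ t g, D (t * g * t⁻¹) = D g) (hreg : ∀ g, p.Coprime (orderOf g) → D g = 0)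
    (z : MonoidAlgebra ℂ G) (hz : ∀ g, z.coeff g ∈ R) :
    ∃ y ∈ R, evalAt D (z ^ p ^ (e + r)) = ((p ^ (r + 1) : ℕ) : ℂ) * y := by
  classical
  have hp : p.Prime := Fact.out
  set q := p ^ (e + r) with hq
  have hq0 : q ≠ 0 := pow_ne_zero _ hp.ne_zero
  have : NeZero q := ⟨hq0⟩
  -- Words of length q are indexed by the cyclic group of order q, which then acts on them by
  -- rotation.
  let A := Multiplicative (ZMod q)
  let γ : A := Multiplicative.ofAdd 1
  have hγ : ∀ n : ℕ, γ ^ n = Multiplicative.ofAdd (n : ZMod q) := fun n => by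
    rw [← ofAdd_nsmul]; simp
  have hγq : γ ^ q = 1 := by rw [hγ]; simp
  have hgen : ∀ a : A, ∃ n : ℕ, γ ^ n = a := fun a => ⟨(Multiplicative.toAdd a).val, by
    rw [hγ, ZMod.natCast_zmod_val]; rfl⟩
  let _ : MulAction A (A → G) := arrowAction
  have hact : ∀ (a : A) (u : A → G) (b : A), (a • u) b = u (a⁻¹ * b) := fun _ _ _ => rfl
  let Φ : (A → G) → ℂ := fun u => (∏ a, z.coeff (u a)) * D (wordProd γ q u)
  have hsum : evalAt D (z ^ q) = ∑ u : A → G, Φ u := by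
    rw [evalAt_pow]
    have hbij : Function.Bijective fun i : Fin q => γ ^ (i : ℕ) := by
      rw [Fintype.bijective_iff_surjective_and_card]
      refine ⟨fun a => ⟨⟨(Multiplicative.toAdd a).val, ZMod.val_lt _⟩, ?_⟩, ?_⟩
      · change γ ^ (Multiplicative.toAdd a).val = a
        rw [hγ, ZMod.natCast_zmod_val]; rfl
      · rw [Fintype.card_multiplicative, ZMod.card, Fintype.card_fin]
    let E : Fin q ≃ A := Equiv.ofBijective _ hbij
    rw [← (E.arrowCongr (Equiv.refl G)).sum_comp]
    refine Finset.sum_congr rfl fun u _ => ?_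
    simp only [Φ]
    congr 1
    · exact Fintype.prod_equiv E _ _ fun i => by simp
    · congr 2
      refine List.ext_getElem (by simp) fun i h1 h2 => ?_
      have hi : i < q := by simpa using h1
      have : E ⟨i, hi⟩ = γ ^ i := rfl
      simp [← this]
  rw [hsum]
  refine exists_sum_eq_mul_of_orbit (A := A) R Φ
    (fun u => R.mul_mem (R.prod_mem fun a _ => hz _) (hD _)) ?_ _ ?_
  · have h1 : ∀ u, Φ (γ • u) = Φ u := fun u => by
      simp only [Φ]
      congr 1
      · exact Fintype.prod_equiv (Equiv.mulLeft γ⁻¹) _ _ fun a => rfl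
      · have h2 : u = fun a => (γ • u) (γ * a) := by
          funext a; rw [hact, inv_mul_cancel_left]
        -- Both sides are the product of the same q + 1 consecutive letters of a periodic word:
        -- rotating by one letter conjugates the product, and D is a class function.
        have h3 := (wordProd_succ γ q (γ • u)).symm.trans (wordProd_succ' γ q (γ • u))
        rw [← h2, hγq] at h3
        rw [eq_mul_inv_of_mul_eq h3]
        exact hconj _ _
    intro a u
    obtain ⟨n, rfl⟩ := hgen a
    induction n with
    | zero => rw [pow_zero, one_smul]
    | succ n ih => rw [pow_succ', mul_smul, h1, ih]
  · intro u hu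
    have hcard : Nat.card (MulAction.orbit A u) ∣ p ^ (e + r) := by
      rw [Nat.card_coe_set_eq, ← MulAction.index_stabilizer]
      have := (MulAction.stabilizer A u).index_dvd_card
      rwa [Nat.card_eq_fintype_card, Fintype.card_multiplicative, ZMod.card] at this
    obtain ⟨j, hj, hj'⟩ := (Nat.dvd_prime_pow hp).1 hcard
    rw [hj']
    refine pow_dvd_pow p ?_
    -- An orbit of size p^j with j ≤ r consists of words of period p^j. The product is then a
    -- p^(e+r-j)-th power with exponent e+r-j ≥ e, hence p-regular because p^e is the p-part of |G|,
    -- and D vanishes there.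
    by_contra hjr
    push Not at hjr
    apply hu
    have hst : γ ^ p ^ j ∈ MulAction.stabilizer A u := by
      rw [← hj', Nat.card_coe_set_eq, ← MulAction.index_stabilizer]
      exact Subgroup.pow_index_mem _ γ
    have hst' : ∀ a, u (γ ^ p ^ j * a) = u a := fun a => by
      have := congrFun (MulAction.mem_stabilizer_iff.1 hst) (γ ^ p ^ j * a)
      rw [hact, inv_mul_cancel_left] at this
      exact this.symm
    have hqj : q = p ^ j * p ^ (e + r - j) := by rw [hq, ← pow_add]; congr 1; omega
    simp only [Φ]
    rw [show wordProd γ q u = wordProd γ (p ^ j) u ^ p ^ (e + r - j) by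
      rw [← wordProd_mul γ _ _ u hst', ← hqj], hreg, mul_zero]
    refine Nat.Coprime.coprime_dvd_right (orderOf_dvd_of_pow_eq_one (n := n') ?_) hn'
    have : e + r - j = e + (r - j) := by omega
    rw [this, pow_add, ← pow_mul, mul_right_comm, ← hG, pow_mul, pow_card_eq_one', one_pow]

end Rotation

end CharacterFields

namespace CharacterFields

/-! ### Values of section functions modulo p. -/

section SectionValues

variable {G : Type*} [Group G]

theorem exists_regular_mul_primary [Finite G] (p : ℕ) [Fact p.Prime] (g : G) :
    ∃ x v : G, g = x * v ∧ x * v = v * x ∧ p.Coprime (orderOf x) ∧ ∃ j, v ^ p ^ j = 1 := by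
  have hp : p.Prime := Fact.out
  obtain ⟨a, m, hm, hn⟩ := Nat.exists_eq_pow_mul_and_not_dvd (orderOf_pos g).ne' p hp.ne_one
  have hcop : IsCoprime ((p ^ a : ℕ) : ℤ) (m : ℤ) :=
    Nat.isCoprime_iff_coprime.2 (((hp.coprime_iff_not_dvd).2 hm).pow_left a)
  obtain ⟨r, s, hrs⟩ := hcop
  have hg : g ^ (((p ^ a : ℕ) : ℤ) * m) = 1 := by
    rw [← Nat.cast_mul, ← hn, zpow_natCast, pow_orderOf_eq_one]
  refine ⟨g ^ (r * (p ^ a : ℕ)), g ^ (s * m), ?_, ?_, ?_, a, ?_⟩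
  · rw [← zpow_add, hrs, zpow_one]
  · rw [← zpow_add, ← zpow_add, add_comm]
  · refine Nat.Coprime.coprime_dvd_right (orderOf_dvd_of_pow_eq_one (n := m) ?_)
      ((hp.coprime_iff_not_dvd).2 hm)
    rw [← zpow_natCast, ← zpow_mul, mul_assoc, mul_comm, zpow_mul, hg, one_zpow]
  · rw [← zpow_natCast, ← zpow_mul, mul_assoc, mul_comm (m : ℤ), mul_comm, zpow_mul, hg, one_zpow]

theorem eq_pow_pow_of_coprime {p : ℕ} {x : G} (hx : p.Coprime (orderOf x)) (j : ℕ) :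
    ∃ k : ℕ, (x ^ p ^ j) ^ k = x := by
  obtain ⟨k, hk⟩ := exists_pow_eq_self_of_coprime (hx.pow_left j)
  exact ⟨k, hk⟩

/-- A high p-power removes v and u from the equation, so t centralizes a p-power of x; as x is
p-regular, it is itself a power of that element. -/
theorem commute_of_section {p : ℕ} {x v u t : G} (hx : p.Coprime (orderOf x))
    (hxv : x * v = v * x) (hxu : x * u = u * x) {i j : ℕ} (hv : v ^ p ^ i = 1)
    (hu : u ^ p ^ j = 1) (h : t⁻¹ * (x * v) * t = x * u) : t * x = x * t := by
  have h1 := congrArg (· ^ p ^ (i + j)) h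
  have hv' : v ^ p ^ (i + j) = 1 := by rw [pow_add, pow_mul, hv, one_pow]
  have hu' : u ^ p ^ (i + j) = 1 := by rw [add_comm, pow_add, pow_mul, hu, one_pow]
  have h2 : ∀ n, (t⁻¹ * (x * v) * t) ^ n = t⁻¹ * (x * v) ^ n * t := fun n => by
    have := conj_pow (i := n) (a := t⁻¹) (b := x * v)
    rwa [inv_inv] at this
  beta_reduce at h1
  rw [h2, (show Commute x v from hxv).mul_pow, (show Commute x u from hxu).mul_pow,
    hv', hu', mul_one] at h1
  obtain ⟨k, hk⟩ := eq_pow_pow_of_coprime hx (i + j)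
  have h3 := congrArg (· ^ k) h1
  have h4 : ∀ (y : G) n, (t⁻¹ * y * t) ^ n = t⁻¹ * y ^ n * t := fun y n => by
    have := conj_pow (i := n) (a := t⁻¹) (b := y)
    rwa [inv_inv] at this
  beta_reduce at h3
  rw [h4, hk, mul_assoc, inv_mul_eq_iff_eq_mul] at h3
  exact h3.symm

theorem exists_conj_of_sectionFun_ne_zero [Fintype G] {x : G} {P : Subgroup G} {g : G}
    (h : sectionFun x P g ≠ 0) : ∃ t, ∃ u ∈ P, g = t * (x * u) * t⁻¹ := by
  classical
  rw [sectionFun] at h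
  have h1 : (Finset.univ.filter fun t : G => x⁻¹ * (t⁻¹ * g * t) ∈ P).card ≠ 0 := fun h0 =>
    h (by rw [h0]; simp)
  obtain ⟨t, ht⟩ := Finset.card_pos.1 (Nat.pos_of_ne_zero h1)
  exact ⟨t, _, (Finset.mem_filter.1 ht).2, by group⟩

/-- Every t that is counted centralizes x, so the value is the number of fixed points of the p-group
⟨v⟩ on C/P with C the centralizer of x. That number is congruent modulo p to the index of P in C,
which is prime to p. -/
theorem sectionFun_mul_primary [Fintype G] {p : ℕ} [Fact p.Prime] {x v : G}
    (hx : p.Coprime (orderOf x)) {P : Subgroup G} (hP : IsPGroup p P)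
    (hPC : P ≤ Subgroup.centralizer {x})
    (hindex : ¬ p ∣ (P.subgroupOf (Subgroup.centralizer {x})).index)
    (hxv : x * v = v * x) {i : ℕ} (hv : v ^ p ^ i = 1) :
    ∃ n : ℕ, sectionFun x P (x * v) = n ∧ ¬ p ∣ n := by
  classical
  have hp : p.Prime := Fact.out
  have hxP : ∀ u ∈ P, x * u = u * x := fun u hu =>
    (Subgroup.mem_centralizer_singleton_iff.1 (hPC hu)).symm
  set C := Subgroup.centralizer {x} with hC
  have hmem : ∀ t, t ∈ C ↔ t * x = x * t := fun t => Subgroup.mem_centralizer_singleton_iff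
  let v' : C := ⟨v, (hmem v).2 hxv.symm⟩
  let P' := P.subgroupOf C
  let A := Subgroup.zpowers v'
  have hA : IsPGroup p A := by
    rintro ⟨_, n, rfl⟩
    refine ⟨i, Subtype.ext ?_⟩
    change (v' ^ n) ^ p ^ i = 1
    have h1 : v' ^ p ^ i = 1 := Subtype.ext hv
    rw [← zpow_natCast, ← zpow_mul, mul_comm, zpow_mul, zpow_natCast, h1, one_zpow]
  let S : Set (C ⧸ P') := MulAction.fixedPoints A (C ⧸ P')
  have hS : Nat.card (C ⧸ P') ≡ Nat.card S [MOD p] := hA.card_modEq_card_fixedPoints _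
  have hfix : ∀ t : C, (t : C ⧸ P') ∈ S ↔ (t : G)⁻¹ * v * t ∈ P := fun t => by
    have h1 : (QuotientGroup.mk (v' * t) : C ⧸ P') = QuotientGroup.mk t ↔
        (t : G)⁻¹ * v * t ∈ P := by
      rw [eq_comm, QuotientGroup.eq, Subgroup.mem_subgroupOf]
      simp [v', mul_assoc]
    rw [← h1]
    constructor
    · intro h
      exact h ⟨v', Subgroup.mem_zpowers v'⟩
    · intro h
      have hle : A ≤ MulAction.stabilizer C (t : C ⧸ P') := by
        rw [Subgroup.zpowers_le]
        exact h
      exact fun a => hle a.2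
  refine ⟨Nat.card S, ?_, fun hd => hindex ((hS.dvd_iff dvd_rfl).2 hd)⟩
  have hcount : (Finset.univ.filter fun t : G => x⁻¹ * (t⁻¹ * (x * v) * t) ∈ P).card =
      Nat.card P * Nat.card S := by
    have e1 : Nat.card ((QuotientGroup.mk : C → C ⧸ P') ⁻¹' S) = Nat.card P' * Nat.card S := by
      rw [Nat.card_congr (QuotientGroup.preimageMkEquivSubgroupProdSet P' S), Nat.card_prod]
    have e2 : Nat.card P' = Nat.card P :=
      Nat.card_congr (Subgroup.subgroupOfEquivOfLe hPC).toEquiv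
    rw [← e2, ← e1, ← Fintype.card_subtype, ← Nat.card_eq_fintype_card]
    have hmemS : ∀ t : G, x⁻¹ * (t⁻¹ * (x * v) * t) ∈ P →
        ∃ h : t ∈ C, (⟨t, h⟩ : C) ∈ (QuotientGroup.mk : C → C ⧸ P') ⁻¹' S := fun t ht => by
      obtain ⟨j, hj⟩ := hP ⟨_, ht⟩
      have hc := commute_of_section (t := t) hx hxv (hxP _ ht) hv (congrArg Subtype.val hj)
        (by group)
      refine ⟨(hmem t).2 hc, (hfix _).2 ?_⟩
      convert ht using 1
      have : t⁻¹ * (x * v) * t = x * (t⁻¹ * v * t) := by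
        have h2 : t⁻¹ * x = x * t⁻¹ := by
          rw [inv_mul_eq_iff_eq_mul, ← mul_assoc, hc, mul_inv_cancel_right]
        simp only [← mul_assoc]
        rw [h2]
      rw [this, inv_mul_cancel_left]
    refine Nat.card_congr
      { toFun := fun t => ⟨⟨t.1, (hmemS t t.2).1⟩, (hmemS t t.2).2⟩
        invFun := fun t => ⟨t.1, ?_⟩
        left_inv := fun t => rfl
        right_inv := fun t => rfl }
    have h1 := (hfix t.1).1 t.2
    have hc := (hmem _).1 t.1.2
    have : (t.1 : G)⁻¹ * (x * v) * t.1 = x * ((t.1 : G)⁻¹ * v * t.1) := by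
      have h2 : (t.1 : G)⁻¹ * x = x * (t.1 : G)⁻¹ := by
        rw [inv_mul_eq_iff_eq_mul, ← mul_assoc, hc, mul_inv_cancel_right]
      simp only [← mul_assoc]
      rw [h2]
    rw [this, inv_mul_cancel_left]
    exact h1
  rw [sectionFun, hcount]
  have : (Nat.card P : ℂ) ≠ 0 := Nat.cast_ne_zero.2 Nat.card_pos.ne'
  push_cast
  rw [inv_mul_cancel_left₀ this]

/-- A Sylow `p`-subgroup of the centralizer of `x`. -/
theorem exists_centralizer_sylow [Finite G] (p : ℕ) [Fact p.Prime] (x : G) :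
    ∃ P : Subgroup G, IsPGroup p P ∧ P ≤ Subgroup.centralizer {x} ∧
      ¬ p ∣ (P.subgroupOf (Subgroup.centralizer {x})).index := by
  let Q : Sylow p (Subgroup.centralizer {x}) := default
  refine ⟨(Q : Subgroup _).map (Subgroup.subtype _), Q.2.map _, Subgroup.map_subtype_le _, ?_⟩
  have : ((Q : Subgroup _).map (Subgroup.subtype (Subgroup.centralizer {x}))).subgroupOf
      (Subgroup.centralizer {x}) = Q := Subgroup.comap_map_eq_self_of_injective
    (Subgroup.subtype_injective _) _
  rw [this]
  exact Q.not_dvd_index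

/-- A nonzero value makes g conjugate to xu with u a p-element commuting with x; p-regularity of g
and x forces u = 1. -/
theorem isConj_of_sectionFun_ne_zero [Fintype G] {p : ℕ} {x : G} {P : Subgroup G}
    (hP : IsPGroup p P) (hPC : P ≤ Subgroup.centralizer {x}) {g : G} (hg : p.Coprime (orderOf g))
    (hx : p.Coprime (orderOf x)) (h : sectionFun x P g ≠ 0) : IsConj x g := by
  obtain ⟨t, u, hu, rfl⟩ := exists_conj_of_sectionFun_ne_zero h
  have hxu : Commute x u := (Subgroup.mem_centralizer_singleton_iff.1 (hPC hu)).symm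
  obtain ⟨j, hj⟩ := hP ⟨u, hu⟩
  have hj : u ^ p ^ j = 1 := congrArg Subtype.val hj
  have hord : orderOf (t * (x * u) * t⁻¹) = orderOf (x * u) :=
    MulEquiv.orderOf_eq (MulAut.conj t) (x * u)
  rw [hord] at hg
  have hu1 : u = 1 := by
    have h1 : u ^ (orderOf x * orderOf (x * u)) = 1 := by
      have h2 : (x * u) ^ (orderOf x * orderOf (x * u)) = 1 := by
        rw [mul_comm, pow_mul, pow_orderOf_eq_one, one_pow]
      rwa [hxu.mul_pow, pow_mul x, pow_orderOf_eq_one, one_pow, one_mul] at h2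
    have h3 : orderOf u ∣ 1 := by
      have hc : (p ^ j).Coprime (orderOf x * orderOf (x * u)) := (hx.mul_right hg).pow_left j
      rw [← hc.gcd_eq_one]
      exact Nat.dvd_gcd (orderOf_dvd_of_pow_eq_one hj) (orderOf_dvd_of_pow_eq_one h1)
    exact orderOf_eq_one_iff.1 (Nat.dvd_one.1 h3)
  rw [hu1, mul_one]
  exact isConj_iff.2 ⟨t, rfl⟩

end SectionValues

end CharacterFields

namespace CharacterFields

/-! ### Central characters and separation of blocks by central elements. -/

section Omega

variable {G : Type*} [Group G] [Fintype G]

/-- The central character of `ψ`, as a function on the group algebra. -/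
noncomputable def omega (ψ : G → ℂ) (z : MonoidAlgebra ℂ G) : ℂ := evalAt ψ z / ψ 1

theorem asAlgebraHom_eq_omega {d : ℕ} (ρ : Representation ℂ G (Fin d → ℂ))
    (hρ : ρ.IsIrreducible) {z : MonoidAlgebra ℂ G} (hz : z ∈ Subring.center (MonoidAlgebra ℂ G)) :
    ρ.asAlgebraHom z = omega ρ.character z • 1 := by
  have h1 := IsIrrChar.one_ne_zero ⟨d, ρ, hρ, rfl⟩
  obtain ⟨c, hc⟩ := exists_smul_one_of_commute ρ (ρ.asAlgebraHom z) fun g => by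
    rw [← Representation.asAlgebraHom_single_one, ← map_mul, ← map_mul,
      Subring.mem_center_iff.1 hz]
  have : omega ρ.character z = c := by
    rw [omega, evalAt_character, hc, map_smul, smul_eq_mul, div_eq_iff h1]
    simp
  rw [this, hc]

theorem evalAt_mul_center {ψ : G → ℂ} (hψ : IsIrrChar ψ) {z : MonoidAlgebra ℂ G}
    (hz : z ∈ Subring.center (MonoidAlgebra ℂ G)) (w : MonoidAlgebra ℂ G) :
    evalAt ψ (z * w) = omega ψ z * evalAt ψ w := by
  obtain ⟨d, ρ, hρ, rfl⟩ := hψ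
  rw [evalAt_character, map_mul, asAlgebraHom_eq_omega ρ hρ hz, smul_mul_assoc, one_mul, map_smul,
    ← evalAt_character, smul_eq_mul]

theorem omega_mul {ψ : G → ℂ} (hψ : IsIrrChar ψ) {z : MonoidAlgebra ℂ G}
    (hz : z ∈ Subring.center (MonoidAlgebra ℂ G)) (w : MonoidAlgebra ℂ G) :
    omega ψ (z * w) = omega ψ z * omega ψ w := by
  rw [omega, evalAt_mul_center hψ hz, mul_div_assoc]
  rfl

theorem evalAt_pow_center {ψ : G → ℂ} (hψ : IsIrrChar ψ) {z : MonoidAlgebra ℂ G}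
    (hz : z ∈ Subring.center (MonoidAlgebra ℂ G)) (n : ℕ) :
    evalAt ψ (z ^ n) = ψ 1 * omega ψ z ^ n := by
  induction n with
  | zero => rw [pow_zero, MonoidAlgebra.one_def, evalAt_single]; simp
  | succ n ih => rw [pow_succ', evalAt_mul_center hψ hz, ih, pow_succ]; ring

theorem omega_sub (ψ : G → ℂ) (z w : MonoidAlgebra ℂ G) :
    omega ψ (z - w) = omega ψ z - omega ψ w := by
  rw [omega, map_sub, sub_div]; rfl

theorem omega_single_one {ψ : G → ℂ} (hψ : IsIrrChar ψ) (c : ℂ) :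
    omega ψ (MonoidAlgebra.single 1 c) = c := by
  rw [omega, evalAt_single, mul_div_assoc, div_self hψ.one_ne_zero, mul_one]

open scoped Classical in
/-- The sum of the conjugacy class of `x` in the group algebra. -/
noncomputable def classSum (x : G) : MonoidAlgebra ℂ G :=
  ∑ y ∈ (conjugatesOf x).toFinset, MonoidAlgebra.single y 1

omit [Fintype G] in
theorem mem_center_of_single {z : MonoidAlgebra ℂ G}
    (h : ∀ g, MonoidAlgebra.single g 1 * z = z * MonoidAlgebra.single g 1) :
    z ∈ Subring.center (MonoidAlgebra ℂ G) := by
  rw [Subring.mem_center_iff]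
  intro w
  induction w using MonoidAlgebra.induction_linear with
  | zero => simp
  | add x y hx hy => rw [mul_add, add_mul, hx, hy]
  | single g r =>
    have : (MonoidAlgebra.single g r : MonoidAlgebra ℂ G) = r • MonoidAlgebra.single g 1 := by simp
    rw [this, smul_mul_assoc, h, mul_smul_comm]

theorem classSum_mem_center (x : G) : classSum x ∈ Subring.center (MonoidAlgebra ℂ G) := by
  classical
  refine mem_center_of_single fun g => ?_
  rw [classSum, Finset.mul_sum, Finset.sum_mul]
  refine Finset.sum_bij' (fun y _ => g * y * g⁻¹) (fun y _ => g⁻¹ * y * g) ?_ ?_ ?_ ?_ ?_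
  · intro y hy
    rw [Set.mem_toFinset] at hy ⊢
    change IsConj _ _ at hy ⊢
    exact hy.trans (isConj_iff.2 ⟨g, rfl⟩)
  · intro y hy
    rw [Set.mem_toFinset] at hy ⊢
    change IsConj _ _ at hy ⊢
    exact hy.trans (isConj_iff.2 ⟨g⁻¹, by simp⟩)
  · intro y _; group
  · intro y _; group
  · intro y _; simp [MonoidAlgebra.single_mul_single]

omit [Fintype G] in
theorem single_one_mem_center (c : ℂ) :
    (MonoidAlgebra.single 1 c : MonoidAlgebra ℂ G) ∈ Subring.center (MonoidAlgebra ℂ G) :=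
  mem_center_of_single fun g => by simp [MonoidAlgebra.single_mul_single]

theorem omega_classSum {ψ : G → ℂ} (hψ : IsChar ψ) (x : G) :
    omega ψ (classSum x) = centralChar ψ x := by
  classical
  rw [omega, centralChar, classSum, map_sum]
  congr 1
  have : ∀ y ∈ (conjugatesOf x).toFinset, evalAt ψ (MonoidAlgebra.single y 1) = ψ x := by
    intro y hy
    rw [Set.mem_toFinset] at hy
    change IsConj _ _ at hy
    obtain ⟨t, rfl⟩ := isConj_iff.1 hy
    rw [evalAt_single, one_mul, hψ.conj]
  rw [Finset.sum_congr rfl this, Finset.sum_const, nsmul_eq_mul, Set.ncard_eq_toFinset_card']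

/-- The class sum already lies in ℤ[G], which is finite over ℤ, so the scalar by which it acts is
integral. -/
theorem omega_classSum_mem {ψ : G → ℂ} (hψ : IsIrrChar ψ) (x : G) :
    omega ψ (classSum x) ∈ AlgInt := by
  classical
  obtain ⟨d, ρ, hρ, rfl⟩ := hψ
  have h1 := IsIrrChar.one_ne_zero ⟨d, ρ, hρ, rfl⟩
  have hd : (d : ℂ) ≠ 0 := by simpa using h1
  have : Nonempty (Fin d) := ⟨⟨0, Nat.pos_of_ne_zero (by exact_mod_cast hd)⟩⟩
  let f : MonoidAlgebra ℤ G →ₐ[ℤ] End ℂ (Fin d → ℂ) := MonoidAlgebra.lift ℤ _ G ρ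
  let z : MonoidAlgebra ℤ G := ∑ y ∈ (conjugatesOf x).toFinset, MonoidAlgebra.single y 1
  have hfin : Module.Finite ℤ (MonoidAlgebra ℤ G) := inferInstance
  have hz : IsIntegral ℤ z := IsIntegral.of_finite ℤ z
  have hfz : f z = algebraMap ℂ (End ℂ (Fin d → ℂ)) (omega ρ.character (classSum x)) := by
    rw [Algebra.algebraMap_eq_smul_one, ← asAlgebraHom_eq_omega ρ hρ (classSum_mem_center x)]
    simp [f, z, classSum]
  have h2 := hz.map f
  rw [hfz] at h2
  exact (isIntegral_algebraMap_iff (FaithfulSMul.algebraMap_injective _ _)).1 h2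

theorem finite_isIrrChar : {ψ : G → ℂ | IsIrrChar ψ}.Finite := by
  classical
  have h : LinearIndependent ℂ (fun ψ : {ψ : G → ℂ | IsIrrChar ψ} => (ψ : G → ℂ)) := by
    rw [linearIndependent_iff']
    intro s c hs ψ hψ
    have h1 : ∑ g, (∑ θ ∈ s, c θ • (θ : G → ℂ)) g * (ψ : G → ℂ) g⁻¹ = c ψ * Nat.card G := by
      simp only [Finset.sum_apply, Pi.smul_apply, smul_eq_mul, Finset.sum_mul, mul_assoc]
      rw [Finset.sum_comm, Finset.sum_eq_single ψ]
      · rw [← Finset.mul_sum, IsIrrChar.sum_mul ψ.2 ψ.2, if_pos rfl]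
      · intro θ _ hne
        rw [← Finset.mul_sum, IsIrrChar.sum_mul θ.2 ψ.2, if_neg (fun h => hne (Subtype.ext h)),
          mul_zero]
      · exact fun h => absurd hψ h
    rw [hs] at h1
    simp only [Pi.zero_apply, zero_mul, Finset.sum_const_zero] at h1
    exact (mul_eq_zero.1 h1.symm).resolve_right (Nat.cast_ne_zero.2 Nat.card_pos.ne')
  exact h.setFinite

theorem coeff_mul_mem (R : Subring ℂ) {z w : MonoidAlgebra ℂ G} (hz : ∀ g, z.coeff g ∈ R)
    (hw : ∀ g, w.coeff g ∈ R) (g : G) : (z * w).coeff g ∈ R := by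
  classical
  have : ∀ y : MonoidAlgebra ℂ G, y.coeff g = evalAt (fun h => if h = g then 1 else 0) y :=
    fun y => by simp [evalAt_apply]
  rw [this, evalAt_mul]
  refine R.sum_mem fun h _ => R.mul_mem (hz h) ?_
  rw [evalAt_apply]
  refine R.sum_mem fun h' _ => R.mul_mem (hw h') ?_
  split_ifs
  exacts [R.one_mem, R.zero_mem]

/-- A central element with integral coefficients separating `χ` from a finite set of characters
outside its block. -/
theorem exists_central_separating (M : Ideal AlgInt) (hM : M.IsPrime) {χ : G → ℂ}
    (hχ : IsIrrChar χ) {T : Set (G → ℂ)} (hT : T.Finite)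
    (h : ∀ ψ ∈ T, IsIrrChar ψ ∧ ψ ∉ blockOf M χ) :
    ∃ z ∈ Subring.center (MonoidAlgebra ℂ G), (∀ g, z.coeff g ∈ AlgInt.toSubring) ∧
      (∀ ψ, IsIrrChar ψ → omega ψ z ∈ AlgInt) ∧ (∃ a : AlgInt, a ∉ M ∧ (a : ℂ) = omega χ z) ∧
      ∀ ψ ∈ T, omega ψ z = 0 := by
  classical
  induction T, hT using Set.Finite.induction_on with
  | empty =>
    refine ⟨1, one_mem _, fun g => ?_, fun ψ hψ => ?_, ⟨1, ?_, ?_⟩, by simp⟩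
    · rw [MonoidAlgebra.one_def, MonoidAlgebra.coeff_single, Finsupp.single_apply]
      split_ifs
      exacts [one_mem _, zero_mem _]
    · rw [MonoidAlgebra.one_def, omega_single_one hψ]; exact one_mem _
    · exact (Ideal.ne_top_iff_one M).1 hM.ne_top
    · rw [MonoidAlgebra.one_def, omega_single_one hχ]; rfl
  | @insert θ T hθ hT ih =>
    obtain ⟨z, hzc, hzi, hzo, ⟨a, ha, haz⟩, hz0⟩ :=
      ih fun ψ hψ => h ψ (Set.mem_insert_of_mem θ hψ)
    obtain ⟨hθi, hθB⟩ := h θ (Set.mem_insert θ T)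
    obtain ⟨x, hx⟩ : ∃ x, ∀ b ∈ M, (b : ℂ) ≠ centralChar θ x - centralChar χ x := by
      by_contra hcon
      push Not at hcon
      exact hθB ⟨hθi, hcon⟩
    -- Multiplying by w kills θ, while the value of the central character of χ at w lies outside M;
    -- primality of M keeps the product outside M.
    let w := classSum x - MonoidAlgebra.single 1 (centralChar θ x)
    have hθx : centralChar θ x ∈ AlgInt := by
      rw [← omega_classSum hθi.isChar]; exact omega_classSum_mem hθi x
    have hχx : centralChar χ x ∈ AlgInt := by
      rw [← omega_classSum hχ.isChar]; exact omega_classSum_mem hχ x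
    have how : ∀ ψ, IsIrrChar ψ → omega ψ w = centralChar ψ x - centralChar θ x := fun ψ hψ => by
      rw [omega_sub, omega_classSum hψ.isChar, omega_single_one hψ]
    have hwc : w ∈ Subring.center (MonoidAlgebra ℂ G) :=
      sub_mem (classSum_mem_center x) (single_one_mem_center _)
    refine ⟨z * w, mul_mem hzc hwc, coeff_mul_mem _ hzi fun g => ?_, fun ψ hψ => ?_,
      ⟨a * ⟨centralChar χ x - centralChar θ x, sub_mem hχx hθx⟩, ?_, ?_⟩, fun ψ hψ => ?_⟩
    · simp only [w, MonoidAlgebra.coeff_sub, classSum, Finsupp.coe_sub, Pi.sub_apply,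
        MonoidAlgebra.coeff_sum, Finsupp.finsetSum_apply, MonoidAlgebra.coeff_single,
        Finsupp.single_apply]
      refine sub_mem (sum_mem fun y _ => ?_) ?_
      · split_ifs
        exacts [one_mem _, zero_mem _]
      · split_ifs
        exacts [hθx, zero_mem _]
    · rw [omega_mul hψ hzc, how ψ hψ]
      refine mul_mem (hzo ψ hψ) (sub_mem ?_ hθx)
      rw [← omega_classSum hψ.isChar]
      exact omega_classSum_mem hψ x
    · intro hmem
      rcases hM.mem_or_mem hmem with h1 | h1
      · exact ha h1
      · exact hx _ (M.neg_mem h1) (by simp)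
    · rw [omega_mul hχ hzc, how χ hχ, ← haz]; rfl
    · rcases Set.mem_insert_iff.1 hψ with rfl | hψ'
      · rw [omega_mul hθi hzc, how _ hθi, sub_self, mul_zero]
      · rw [omega_mul (h ψ hψ).1 hzc, hz0 ψ hψ', zero_mul]

end Omega

end CharacterFields

namespace CharacterFields

/-! ### Height zero forces a value not divisible by p on a p-regular element. -/

section HeightZero

variable {G : Type*} [Group G]

theorem IsChar.charDegree_eq {ψ : G → ℂ} (h : IsChar ψ) : ψ 1 = charDegree ψ := by
  obtain ⟨d, ρ, rfl⟩ := h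
  rw [charDegree_character]
  simp

theorem IsIrrChar.charDegree_ne_zero {ψ : G → ℂ} (h : IsIrrChar ψ) : charDegree ψ ≠ 0 := fun h0 =>
  h.one_ne_zero (by rw [h.isChar.charDegree_eq, h0, Nat.cast_zero])

theorem le_padicValNat_of_charHeight_eq_zero {p : ℕ} {M : Ideal AlgInt} {χ : G → ℂ}
    (h : charHeight p M χ = 0) {ψ : G → ℂ} (hψ : ψ ∈ blockOf M χ) :
    padicValNat p (charDegree χ) ≤ padicValNat p (charDegree ψ) := by
  have h1 : padicValNat p (charDegree χ) =
      sInf ((fun ψ => padicValNat p (charDegree ψ)) '' blockOf M χ) := by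
    unfold charHeight blockDefect at h
    omega
  rw [h1]
  exact Nat.sInf_le ⟨ψ, hψ, rfl⟩

variable [Fintype G]

omit [Group G] in
theorem evalAt_fun_add (φ ψ : G → ℂ) (z : MonoidAlgebra ℂ G) :
    evalAt (φ + ψ) z = evalAt φ z + evalAt ψ z := by
  simp [evalAt_apply, mul_add, Finset.sum_add_distrib]

omit [Group G] in
theorem evalAt_fun_smul (a : ℂ) (φ : G → ℂ) (z : MonoidAlgebra ℂ G) :
    evalAt (a • φ) z = a * evalAt φ z := by
  simp [evalAt_apply, Finset.mul_sum, mul_left_comm]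

theorem exists_evalAt_eq_mul {z : MonoidAlgebra ℂ G}
    (hz : z ∈ Subring.center (MonoidAlgebra ℂ G)) {m q : ℕ}
    (h : ∀ ψ, IsIrrChar ψ → ∃ y ∈ AlgInt, ψ 1 * omega ψ z ^ q = m * y) {φ : G → ℂ}
    (hφ : φ ∈ charSpan G) : ∃ y ∈ AlgInt, evalAt φ (z ^ q) = m * y := by
  refine charSpan_induction (p := fun φ => ∃ y ∈ AlgInt, evalAt φ (z ^ q) = m * y)
    (fun φ hφ => ?_) ⟨0, zero_mem _, by simp [evalAt_apply]⟩ ?_ ?_ hφ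
  · obtain ⟨s, hs, rfl⟩ := hφ.exists_multiset
    clear hφ
    induction s using Multiset.induction_on with
    | empty => exact ⟨0, zero_mem _, by simp [evalAt_apply]⟩
    | cons ψ s ih =>
      obtain ⟨y, hy, h1⟩ := ih fun ψ h => hs ψ (Multiset.mem_cons_of_mem h)
      have hψ := hs ψ (Multiset.mem_cons_self ψ s)
      obtain ⟨y', hy', h2⟩ := h ψ hψ
      refine ⟨y' + y, add_mem hy' hy, ?_⟩
      rw [Multiset.sum_cons, evalAt_fun_add, h1, evalAt_pow_center hψ hz, h2, mul_add]
  · rintro φ ψ ⟨y, hy, h1⟩ ⟨y', hy', h2⟩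
    exact ⟨y + y', add_mem hy hy', by rw [evalAt_fun_add, h1, h2, mul_add]⟩
  · rintro a ha φ ⟨y, hy, h1⟩
    exact ⟨a * y, mul_mem ha hy, by rw [evalAt_fun_smul, h1, mul_left_comm]⟩

theorem natCast_notMem_of_not_dvd {p : ℕ} (hp : p.Prime) {M : Ideal AlgInt} (hM : M.IsPrime)
    (hpM : (p : AlgInt) ∈ M) {n : ℕ} (hn : ¬ p ∣ n) : (n : AlgInt) ∉ M := by
  intro hmem
  have hc : IsCoprime (p : ℤ) (n : ℤ) := Nat.isCoprime_iff_coprime.2 ((hp.coprime_iff_not_dvd).2 hn)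
  obtain ⟨a, b, hab⟩ := hc
  apply (Ideal.ne_top_iff_one M).1 hM.ne_top
  have : ((a * p + b * n : ℤ) : AlgInt) = 1 := by rw [hab]; simp
  rw [← this]
  push_cast
  exact M.add_mem (M.mul_mem_left _ hpM) (M.mul_mem_left _ hmem)

/-- Representatives of the `p`-regular conjugacy classes. -/
theorem exists_regular_class_reps (p : ℕ) : ∃ S : Finset G,
    (∀ x ∈ S, p.Coprime (orderOf x)) ∧ (∀ x ∈ S, ∀ x' ∈ S, IsConj x x' → x = x') ∧
      ∀ g : G, p.Coprime (orderOf g) → ∃ x ∈ S, IsConj x g := by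
  classical
  let f : G → G := fun g => Quotient.out (ConjClasses.mk g)
  have hf : ∀ g, IsConj (f g) g := fun g => Quotient.exact (Quotient.out_eq (ConjClasses.mk g))
  have hff : ∀ g g', IsConj g g' → f g = f g' := fun g g' h => by
    simp only [f]
    rw [ConjClasses.mk_eq_mk_iff_isConj.2 h]
  refine ⟨(Finset.univ.image f).filter fun x => p.Coprime (orderOf x),
    fun x hx => (Finset.mem_filter.1 hx).2, ?_, ?_⟩
  · intro x hx x' hx' hc
    obtain ⟨g, -, rfl⟩ := Finset.mem_image.1 (Finset.mem_filter.1 hx).1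
    obtain ⟨g', -, rfl⟩ := Finset.mem_image.1 (Finset.mem_filter.1 hx').1
    exact hff _ _ ((hf g).symm.trans (hc.trans (hf g')))
  · intro g hg
    refine ⟨f g, Finset.mem_filter.2 ⟨Finset.mem_image_of_mem f (Finset.mem_univ g), ?_⟩, hf g⟩
    obtain ⟨t, ht⟩ := isConj_iff.1 (hf g)
    rw [← ht] at hg
    rwa [← MulEquiv.orderOf_eq (MulAut.conj t) (f g)]

set_option maxHeartbeats 1000000 in
/-- A character of `p`-height zero takes a value not divisible by `p` on a `p`-regular element. -/
theorem exists_regular_not_dvd {p : ℕ} [Fact p.Prime] {M : Ideal AlgInt} (hM : M.IsPrime)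
    (hpM : (p : AlgInt) ∈ M) {χ : G → ℂ} (hχ : IsIrrChar χ) (h0 : charHeight p M χ = 0) :
    ∃ x : G, p.Coprime (orderOf x) ∧ ¬ ∃ y ∈ AlgInt, χ x = p * y := by
  classical
  have hp : p.Prime := Fact.out
  by_contra hcon
  push Not at hcon
  have hcon' : ∀ x : G, ∃ y ∈ AlgInt, p.Coprime (orderOf x) → χ x = p * y := fun x => by
    by_cases hx : p.Coprime (orderOf x)
    · obtain ⟨y, hy, h⟩ := hcon x hx
      exact ⟨y, hy, fun _ => h⟩
    · exact ⟨0, zero_mem _, fun h => absurd h hx⟩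
  choose Y hY hχY using hcon'
  choose P hP hPC hPi using exists_centralizer_sylow (G := G) p
  have hxP : ∀ x, ∀ u ∈ P x, x * u = u * x := fun x u hu =>
    (Subgroup.mem_centralizer_singleton_iff.1 (hPC x hu)).symm
  have hn : ∀ x : G, ∃ n : ℕ, p.Coprime (orderOf x) → sectionFun x (P x) x = n ∧ ¬ p ∣ n := by
    intro x
    by_cases hx : p.Coprime (orderOf x)
    · obtain ⟨n, h1, h2⟩ := sectionFun_mul_primary hx (hP x) (hPC x) (hPi x) (v := 1) (by simp)
        (i := 0) (by simp)
      rw [mul_one] at h1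
      exact ⟨n, fun _ => ⟨h1, h2⟩⟩
    · exact ⟨0, fun h => absurd h hx⟩
  choose n hn using hn
  set h := padicValNat p (charDegree χ) with hh
  obtain ⟨e, n', hn', hG⟩ := Nat.exists_eq_pow_mul_and_not_dvd
    (Nat.card_pos (α := G)).ne' p hp.ne_one
  obtain ⟨z, hzc, hzi, hzo, ⟨a, ha, haz⟩, hz0⟩ := exists_central_separating M hM hχ
    (T := {ψ | IsIrrChar ψ} \ blockOf M χ) (finite_isIrrChar.sdiff) (fun ψ hψ => ⟨hψ.1, hψ.2⟩)
  set q := p ^ (e + h) with hq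
  have hq0 : q ≠ 0 := pow_ne_zero _ hp.ne_zero
  have hdiv : ∀ ψ, IsIrrChar ψ → ∃ y ∈ AlgInt, ψ 1 * omega ψ z ^ q = (p ^ h : ℕ) * y := by
    intro ψ hψ
    -- Inside the block, height zero makes p^h divide the degree of ψ; outside it, z acts as zero.
    by_cases hB : ψ ∈ blockOf M χ
    · obtain ⟨m, hm⟩ : p ^ h ∣ charDegree ψ :=
        (pow_dvd_pow p (le_padicValNat_of_charHeight_eq_zero h0 hB)).trans pow_padicValNat_dvd
      refine ⟨m * omega ψ z ^ q, mul_mem (natCast_mem _ m) (pow_mem (hzo ψ hψ) q), ?_⟩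
      rw [hψ.isChar.charDegree_eq, hm]
      push_cast
      ring
    · exact ⟨0, zero_mem _, by rw [hz0 ψ ⟨hψ, hB⟩, zero_pow hq0]; ring⟩
  have hsec : ∀ x, ∃ y ∈ AlgInt, evalAt (sectionFun x (P x)) (z ^ q) = (p ^ h : ℕ) * y := fun x =>
    exists_evalAt_eq_mul hzc hdiv (sectionFun_mem_charSpan x (P x) (hxP x))
  choose W hW hWe using hsec
  obtain ⟨S, hS, hSconj, hSex⟩ := exists_regular_class_reps (G := G) p
  -- The function χ - ∑ χ(x)/n(x) · `sectionFun x (P x)` vanishes on p-regular elements; D is this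
  -- function multiplied by ∏ n(x), with N(x) = ∏ n / n(x), to keep coefficients integral.
  let N : G → ℕ := fun x => ∏ x' ∈ S.erase x, n x'
  let D : G → ℂ := ((∏ x ∈ S, n x : ℕ) : ℂ) • χ -
    ∑ x ∈ S, ((N x : ℂ) * χ x) • sectionFun x (P x)
  have hχint := hχ.isChar.mem_algInt
  have hDmem : D ∈ charSpan G := by
    refine sub_mem (smul_mem_charSpan hχ.isChar.mem_charSpan (natCast_mem _ _))
      (sum_mem fun x _ => smul_mem_charSpan (sectionFun_mem_charSpan x (P x) (hxP x)) ?_)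
    exact mul_mem (natCast_mem _ _) (hχint x)
  have hDreg : ∀ g, p.Coprime (orderOf g) → D g = 0 := by
    intro g hg
    obtain ⟨x, hxS, hxg⟩ := hSex g hg
    have hχg : χ g = χ x := by
      obtain ⟨t, rfl⟩ := isConj_iff.1 hxg
      exact hχ.isChar.conj t x
    have hfg : sectionFun x (P x) g = n x := by
      rw [← (hn x (hS x hxS)).1]
      obtain ⟨t, rfl⟩ := isConj_iff.1 hxg
      exact conj_of_mem_charSpan (sectionFun_mem_charSpan x (P x) (hxP x)) t x
    simp only [D, Pi.sub_apply, Pi.smul_apply, smul_eq_mul, Finset.sum_apply]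
    rw [Finset.sum_eq_single x, hfg, hχg, ← Finset.prod_erase_mul S n hxS]
    · simp only [N]
      push_cast
      ring
    · intro x' hx' hne
      by_cases hz : sectionFun x' (P x') g = 0
      · rw [hz, mul_zero]
      · exact absurd (hSconj x' hx' x hxS ((isConj_of_sectionFun_ne_zero (hP x') (hPC x') hg
          (hS x' hx') hz).trans hxg.symm)) hne
    · exact fun h => absurd hxS h
  -- Taking r = h matches the exponent q = p^(e+h) and yields one factor p more than the degrees
  -- give.
  obtain ⟨y, hy, hye⟩ := exists_evalAt_pow_eq (e := e) (r := h) hG ((hp.coprime_iff_not_dvd).2 hn')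
    AlgInt.toSubring D (fun g => apply_mem_algInt hDmem g) (conj_of_mem_charSpan hDmem) hDreg z hzi
  obtain ⟨m, hm⟩ : p ^ h ∣ charDegree χ := pow_padicValNat_dvd
  have hpm : ¬ p ∣ m := by
    intro hd
    have h1 : p ^ (h + 1) ∣ charDegree χ := by
      rw [hm, pow_succ]; exact mul_dvd_mul_left _ hd
    exact pow_succ_padicValNat_not_dvd hχ.charDegree_ne_zero h1
  have hDe : evalAt D (z ^ q) = ((∏ x ∈ S, n x : ℕ) : ℂ) * (((p ^ h * m : ℕ) : ℂ) * omega χ z ^ q) -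
      ∑ x ∈ S, ((N x : ℂ) * χ x) * ((p ^ h : ℕ) * W x) := by
    have h1 : evalAt D (z ^ q) = ((∏ x ∈ S, n x : ℕ) : ℂ) * evalAt χ (z ^ q) -
        ∑ x ∈ S, ((N x : ℂ) * χ x) * evalAt (sectionFun x (P x)) (z ^ q) := by
      simp only [D, evalAt_apply, Pi.sub_apply, Pi.smul_apply, Finset.sum_apply, smul_eq_mul,
        mul_sub, Finset.sum_sub_distrib, Finset.mul_sum]
      congr 1
      · exact Finset.sum_congr rfl fun g _ => by ring
      · rw [Finset.sum_comm]
        exact Finset.sum_congr rfl fun x _ => Finset.sum_congr rfl fun g _ => by ring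
    rw [h1, evalAt_pow_center hχ hzc, hχ.isChar.charDegree_eq, hm]
    congr 1
    exact Finset.sum_congr rfl fun x _ => by rw [hWe]
  let V : ℂ := y + ∑ x ∈ S, (N x : ℂ) * Y x * W x
  have hV : V ∈ AlgInt := add_mem hy (sum_mem fun x _ =>
    mul_mem (mul_mem (natCast_mem _ _) (hY x)) (hW x))
  -- Each section term carries p^h from its evaluation and another p from χ(x) = p · Y(x), so p
  -- survives after p^h is cancelled. None of the factors on the left reduces to zero modulo M, a
  -- contradiction.
  have hfin : ((∏ x ∈ S, n x : ℕ) : ℂ) * ((m : ℂ) * omega χ z ^ q) = p * V := by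
    have hph : ((p ^ h : ℕ) : ℂ) ≠ 0 := Nat.cast_ne_zero.2 (pow_ne_zero _ hp.ne_zero)
    apply mul_left_cancel₀ hph
    have h2 : ∑ x ∈ S, ((N x : ℂ) * χ x) * ((p ^ h : ℕ) * W x) =
        (p ^ h : ℕ) * (p * ∑ x ∈ S, (N x : ℂ) * Y x * W x) := by
      rw [Finset.mul_sum, Finset.mul_sum]
      refine Finset.sum_congr rfl fun x hx => ?_
      rw [hχY x (hS x hx)]
      ring
    rw [hye, h2] at hDe
    simp only [V]
    push_cast at hDe ⊢
    linear_combination -hDe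
  have hmem : ((∏ x ∈ S, n x : ℕ) : AlgInt) * ((m : AlgInt) * a ^ q) ∈ M := by
    have : ((∏ x ∈ S, n x : ℕ) : AlgInt) * ((m : AlgInt) * a ^ q) = (p : AlgInt) * ⟨V, hV⟩ := by
      apply Subtype.ext
      rw [← haz] at hfin
      simpa using hfin
    rw [this]
    exact M.mul_mem_right _ hpM
  rcases hM.mem_or_mem hmem with h1 | h1
  · refine natCast_notMem_of_not_dvd hp hM hpM ?_ h1
    rw [hp.prime.dvd_finsetProd_iff]
    rintro ⟨x, hx, hd⟩
    exact (hn x (hS x hx)).2 hd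
  · rcases hM.mem_or_mem h1 with h2 | h2
    · exact natCast_notMem_of_not_dvd hp hM hpM hpm h2
    · exact ha (hM.mem_of_pow_mem q h2)

end HeightZero

end CharacterFields

namespace CharacterFields

/-! ### Monomiality of nilpotent groups and Frobenius reciprocity. -/

section Monomial

/-- Apply to the relation a polynomial in f that vanishes at every occurring eigenvalue except α. -/
theorem sum_filter_eigenvalue_eq_zero {V ι : Type*} [AddCommGroup V] [Module ℂ V] [DecidableEq ι]
    (f : End ℂ V) (s : Finset ι) (μ : ι → ℂ) (y : ι → V) (hy : ∀ i ∈ s, f (y i) = μ i • y i)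
    (α : ℂ) (h : ∑ i ∈ s, y i = 0) : ∑ i ∈ s with μ i = α, y i = 0 := by
  classical
  let p : Polynomial ℂ := ∏ ν ∈ (s.image μ).erase α, (Polynomial.X - Polynomial.C ν)
  have hp : ∀ i ∈ s, Polynomial.aeval f p (y i) = p.eval (μ i) • y i := fun i hi =>
    Module.End.aeval_apply_of_mem_apply_eq_smul (hy i hi)
  have hα : p.eval α ≠ 0 := by
    rw [Polynomial.eval_prod, Finset.prod_ne_zero_iff]
    intro ν hν
    simpa [sub_eq_zero] using (Finset.ne_of_mem_erase hν).symm
  have h0 : ∀ i ∈ s, μ i ≠ α → p.eval (μ i) = 0 := fun i hi hne => by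
    rw [Polynomial.eval_prod]
    exact Finset.prod_eq_zero (Finset.mem_erase.2 ⟨hne, Finset.mem_image_of_mem μ hi⟩) (by simp)
  have h1 := congrArg (Polynomial.aeval f p) h
  rw [map_zero, map_sum, Finset.sum_congr rfl hp] at h1
  have h2 : ∑ i ∈ s, p.eval (μ i) • y i = p.eval α • ∑ i ∈ s with μ i = α, y i := by
    rw [Finset.smul_sum, Finset.sum_filter]
    refine Finset.sum_congr rfl fun i hi => ?_
    split_ifs with hc
    · rw [hc]
    · rw [h0 i hi hc, zero_smul]
  rw [h2] at h1
  exact (smul_eq_zero.1 h1).resolve_left hα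

variable {E : Type*} [Group E] [Fintype E]

-- Clifford-style induction on dim W. If T does not act by scalars, take a nonscalar a in T at the
-- lowest possible level of the upper central series; its commutators with T are then scalar on W,
-- so T permutes the eigenspaces of a. Pass to one eigenspace and its stabilizer. The last clause
-- expresses independence of the coset translates: a relation among the vectors ρ(t)v over T
-- restricts to one over H.
open scoped Classical in
theorem exists_eigenline_aux [Group.IsNilpotent E] {V : Type*} [AddCommGroup V] [Module ℂ V]
    [FiniteDimensional ℂ V] (ρ : Representation ℂ E V) (n : ℕ) :
    ∀ (T : Subgroup E) (W : Submodule ℂ V), W ≠ ⊥ → (∀ t ∈ T, ∀ w ∈ W, ρ t w ∈ W) →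
      finrank ℂ W = n → ∃ H ≤ T, ∃ v ∈ W, v ≠ 0 ∧ (∀ h ∈ H, ∃ c : ℂ, ρ h v = c • v) ∧
        ∀ x : E → ℂ, ∑ t with t ∈ T, x t • ρ t v = 0 → ∑ h with h ∈ H, x h • ρ h v = 0 := by
  induction n using Nat.strong_induction_on with
  | _ n ih =>
  intro T W hW hT hn
  by_cases hs : ∀ t ∈ T, ∃ c : ℂ, ∀ w ∈ W, ρ t w = c • w
  · obtain ⟨v, hv, hv0⟩ := Submodule.exists_mem_ne_zero_of_ne_bot hW
    exact ⟨T, le_rfl, v, hv, hv0, fun h hh => (hs h hh).imp fun c hc => hc v hv, fun _ h => h⟩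
  obtain ⟨a, haT, hans, hacomm⟩ : ∃ a ∈ T, (¬ ∃ c : ℂ, ∀ w ∈ W, ρ a w = c • w) ∧
      ∀ t ∈ T, ∃ c : ℂ, ∀ w ∈ W, ρ (a * t * a⁻¹ * t⁻¹) w = c • w := by
    have hex : ∃ i, ∃ a ∈ T, a ∈ Subgroup.upperCentralSeries E i ∧
        ¬ ∃ c : ℂ, ∀ w ∈ W, ρ a w = c • w := by
      obtain ⟨i, hi⟩ := Group.IsNilpotent.nilpotent' (G := E)
      push Not at hs
      obtain ⟨a, ha, hac⟩ := hs
      refine ⟨i, a, ha, by rw [hi]; trivial, ?_⟩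
      push Not
      exact hac
    obtain ⟨a, haT, hai, hans⟩ := Nat.find_spec hex
    have hmin := fun j (hj : j < Nat.find hex) => Nat.find_min hex hj
    refine ⟨a, haT, hans, fun t ht => ?_⟩
    cases hk : Nat.find hex with
    | zero =>
      rw [hk] at hai
      rw [Subgroup.upperCentralSeries_zero, Subgroup.mem_bot] at hai
      exact absurd ⟨1, fun w _ => by rw [hai]; simp⟩ hans
    | succ j =>
      rw [hk, Subgroup.mem_upperCentralSeries_succ_iff] at hai
      by_contra hcon
      refine hmin j (by omega) ⟨_, ?_, hai t, hcon⟩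
      exact T.mul_mem (T.mul_mem (T.mul_mem haT ht) (T.inv_mem haT)) (T.inv_mem ht)
  have hcomm : ∀ t ∈ T, ∃ c : ℂ, ∀ w ∈ W, ρ a (ρ t w) = c • ρ t (ρ a w) := fun t ht => by
    obtain ⟨c, hc⟩ := hacomm t ht
    refine ⟨c, fun w hw => ?_⟩
    rw [← hc _ (hT t ht _ (hT a haT w hw)), ← Module.End.mul_apply, ← Module.End.mul_apply,
      ← Module.End.mul_apply, ← map_mul, ← map_mul, ← map_mul]
    congr 2
    group
  have hWnt : Nontrivial W := Submodule.nontrivial_iff_ne_bot.2 hW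
  obtain ⟨α, hα⟩ := Module.End.exists_eigenvalue ((ρ a).restrict (hT a haT))
  obtain ⟨w₀, hw₀⟩ := hα.exists_hasEigenvector
  have hw₀' : ρ a w₀ = α • (w₀ : V) := congrArg Subtype.val hw₀.apply_eq_smul
  have hw₀0 : (w₀ : V) ≠ 0 := fun h => hw₀.2 (Subtype.ext h)
  let W' : Submodule ℂ V := W ⊓ Module.End.eigenspace (ρ a) α
  have hW' : W' ≠ ⊥ := fun h => hw₀0 <| by
    have : (w₀ : V) ∈ W' := ⟨w₀.2, Module.End.mem_eigenspace_iff.2 hw₀'⟩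
    rw [h] at this
    exact this
  have hlt : finrank ℂ W' < n := by
    rw [← hn]
    refine Submodule.finrank_lt_finrank_of_lt (lt_of_le_of_ne inf_le_left fun h => hans ?_)
    refine ⟨α, fun w hw => ?_⟩
    rw [← h] at hw
    exact Module.End.mem_eigenspace_iff.1 hw.2
  have hinj : ∀ g : E, ∀ w, ρ g w = 0 → w = 0 := fun g w h => by
    have : ρ g⁻¹ (ρ g w) = 0 := by rw [h, map_zero]
    simpa using this
  let T' : Subgroup E :=
    { carrier := {t | t ∈ T ∧ ∀ w ∈ W, ρ a (ρ t w) = ρ t (ρ a w)}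
      one_mem' := ⟨T.one_mem, fun w _ => by simp⟩
      mul_mem' := fun {s t} hs ht => ⟨T.mul_mem hs.1 ht.1, fun w hw => by
        rw [map_mul, Module.End.mul_apply, Module.End.mul_apply, hs.2 _ (hT t ht.1 w hw),
          ht.2 w hw]⟩
      inv_mem' := fun {t} ht => ⟨T.inv_mem ht.1, fun w hw => by
        have h1 := ht.2 _ (hT _ (T.inv_mem ht.1) w hw)
        rw [Representation.self_inv_apply] at h1
        rw [h1, Representation.inv_self_apply]⟩ }
  have hT' : ∀ t ∈ T', ∀ w ∈ W', ρ t w ∈ W' := fun t ht w hw => by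
    refine ⟨hT t ht.1 w hw.1, Module.End.mem_eigenspace_iff.2 ?_⟩
    rw [ht.2 w hw.1, Module.End.mem_eigenspace_iff.1 hw.2, map_smul]
  obtain ⟨H, hHT, v, hv, hv0, hline, hind⟩ := ih _ hlt T' W' hW' hT' rfl
  refine ⟨H, fun h hh => (hHT hh).1, v, hv.1, hv0, hline, fun x hx => hind x ?_⟩
  have hva : ρ a v = α • v := Module.End.mem_eigenspace_iff.1 hv.2
  have hα0 : α ≠ 0 := fun h => hv0 (hinj a v (by rw [hva, h, zero_smul]))
  have hex : ∀ t : E, ∃ c : ℂ, t ∈ T → ∀ w ∈ W, ρ a (ρ t w) = c • ρ t (ρ a w) := fun t => by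
    by_cases ht : t ∈ T
    · exact (hcomm t ht).imp fun c hc _ => hc
    · exact ⟨0, fun h => absurd h ht⟩
  choose c hc using hex
  -- Each ρ(t)v is an eigenvector of ρ(a) with eigenvalue c(t)α, and c(t) = 1 exactly when t lies in
  -- T'.
  have key := sum_filter_eigenvalue_eq_zero (ρ a) (Finset.univ.filter (· ∈ T))
    (fun t => c t * α) (fun t => x t • ρ t v) (fun t ht => by
      rw [map_smul, hc t (Finset.mem_filter.1 ht).2 v hv.1, hva, map_smul, smul_smul, smul_smul,
        smul_smul]
      congr 1
      ring) α hx
  rw [← key]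
  refine Finset.sum_congr ?_ fun _ _ => rfl
  ext t
  simp only [Finset.mem_filter, Finset.mem_univ, true_and]
  constructor
  · intro ht
    refine ⟨ht.1, ?_⟩
    have h1 := hc t ht.1 v hv.1
    rw [ht.2 v hv.1] at h1
    have h2 : (c t - 1) • ρ t (ρ a v) = 0 := by rw [sub_smul, ← h1, one_smul, sub_self]
    rcases smul_eq_zero.1 h2 with h3 | h3
    · rw [sub_eq_zero.1 h3, one_mul]
    · have := hinj a v (hinj t _ h3)
      exact absurd this hv0
  · rintro ⟨ht, h1⟩
    refine ⟨ht, fun w hw => ?_⟩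
    rw [hc t ht w hw, mul_eq_right₀ hα0 |>.1 h1, one_smul]

open scoped Classical in
/-- Irreducible representations of finite nilpotent groups are monomial. -/
theorem exists_eigenline [Group.IsNilpotent E] {V : Type*} [AddCommGroup V] [Module ℂ V]
    [FiniteDimensional ℂ V] [Nontrivial V] (ρ : Representation ℂ E V) :
    ∃ (H : Subgroup E) (v : V) (lam : H →* ℂ), v ≠ 0 ∧ (∀ h : H, ρ h v = lam h • v) ∧
      ∀ x : E → ℂ, ∑ t, x t • ρ t v = 0 → ∀ g, ∑ h : H, x (g * h) * lam h = 0 := by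
  obtain ⟨H, -, v, -, hv0, hline, hind⟩ := exists_eigenline_aux ρ _ ⊤ ⊤ top_ne_bot
    (fun _ _ _ _ => trivial) rfl
  choose c hc using fun h : H => hline h h.2
  have hinj : ∀ a b : ℂ, a • v = b • v → a = b := fun a b h => smul_left_injective ℂ hv0 h
  refine ⟨H, v, ⟨⟨c, hinj _ _ (by rw [← hc]; simp)⟩, fun h h' => hinj _ _ ?_⟩, hv0, hc, ?_⟩
  · change c (h * h') • v = (c h * c h') • v
    rw [← hc, Subgroup.coe_mul, map_mul, Module.End.mul_apply, hc, map_smul, hc, smul_smul,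
      mul_comm]
  intro x hx g
  -- Applying ρ(g⁻¹) to the relation moves the coset gH to H.
  have h1 := hind (fun t => x (g * t)) (by
    have h2 := congrArg (ρ g⁻¹) hx
    rw [map_zero, map_sum] at h2
    rw [← h2]
    simp only [Subgroup.mem_top, Finset.filter_true]
    refine Fintype.sum_equiv (Equiv.mulLeft g) _ _ fun t => ?_
    simp)
  apply hinj
  rw [zero_smul, ← h1, Finset.sum_smul, Finset.sum_subtype (p := (· ∈ H)) _ (by simp)]
  refine Finset.sum_congr rfl fun h _ => ?_
  rw [mul_smul]
  exact congrArg (x (g * h) • ·) (hc h).symm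

/-- The one-dimensional representation given by a linear character. -/
noncomputable def lamRep {H : Type*} [Group H] (lam : H →* ℂ) : Representation ℂ H ℂ :=
  ((algebraMap ℂ (End ℂ ℂ)) : ℂ →* End ℂ ℂ).comp lam

theorem lamRep_apply {H : Type*} [Group H] (lam : H →* ℂ) (h : H) (c : ℂ) :
    lamRep lam h c = lam h * c := by
  simp [lamRep]

theorem character_lamRep {H : Type*} [Group H] (lam : H →* ℂ) : (lamRep lam).character = lam := by
  funext h
  have : lamRep lam h = lam h • 1 := by
    ext; simp [lamRep]
  rw [Representation.character, this]
  simp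

open scoped Classical in
/-- The coefficients of the idempotent of the group algebra attached to a linear character of a
subgroup. -/
noncomputable def idemFun {k G : Type*} [Field k] [Group G] {H : Subgroup G} (lam : H →* k)
    (g : G) : k :=
  if h : g ∈ H then (Nat.card H : k)⁻¹ * lam ⟨g, h⟩⁻¹ else 0

theorem sum_mul_idemFun {k G : Type*} [Field k] [Group G] [Fintype G] {H : Subgroup G} [Fintype H]
    (lam : H →* k) (φ : G → k) :
    ∑ g, φ g * idemFun lam g = (Nat.card H : k)⁻¹ * ∑ h : H, φ h * lam h⁻¹ := by
  classical
  have h1 : ∑ g, φ g * idemFun lam g = ∑ g with g ∈ H, φ g * idemFun lam g := by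
    rw [Finset.sum_filter]
    refine Finset.sum_congr rfl fun g _ => ?_
    split_ifs with h
    · rfl
    · rw [idemFun, dif_neg h, mul_zero]
  rw [h1, Finset.sum_subtype (p := (· ∈ H)) _ (by simp), Finset.mul_sum]
  refine Finset.sum_congr rfl fun h _ => ?_
  rw [idemFun, dif_pos h.2]
  ring

/-- The map from the group algebra onto the orbit span of a vector. -/
noncomputable def orbitMap {V : Type*} [AddCommGroup V] [Module ℂ V] (ρ : Representation ℂ E V)
    (v : V) : (E → ℂ) →ₗ[ℂ] V :=
  ∑ g, (LinearMap.proj g).smulRight (ρ g v)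

theorem orbitMap_apply {V : Type*} [AddCommGroup V] [Module ℂ V] (ρ : Representation ℂ E V)
    (v : V) (x : E → ℂ) : orbitMap ρ v x = ∑ g, x g • ρ g v := by
  simp [orbitMap]

theorem orbitMap_translate {V : Type*} [AddCommGroup V] [Module ℂ V] (ρ : Representation ℂ E V)
    (v : V) (x : E → ℂ) (g : E) : orbitMap ρ v (fun t => x (g⁻¹ * t)) = ρ g (orbitMap ρ v x) := by
  rw [orbitMap_apply, orbitMap_apply, map_sum]
  refine (Fintype.sum_equiv (Equiv.mulLeft g) _ _ fun t => ?_).symm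
  simp

theorem orbitMap_single [DecidableEq E] {V : Type*} [AddCommGroup V] [Module ℂ V]
    (ρ : Representation ℂ E V) (v : V) : orbitMap ρ v (Pi.single 1 1) = v := by
  rw [orbitMap_apply, Finset.sum_eq_single 1]
  · simp
  · intro g _ hg; simp [hg]
  · simp

theorem orbitMap_surjective {V : Type*} [AddCommGroup V] [Module ℂ V] (ρ : Representation ℂ E V)
    (hρ : ρ.IsIrreducible) {v : V} (hv : v ≠ 0) : Function.Surjective (orbitMap ρ v) := by
  classical
  rw [← LinearMap.range_eq_top]
  let U : Subrepresentation ρ :=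
    { toSubmodule := LinearMap.range (orbitMap ρ v)
      apply_mem_toSubmodule := by
        rintro g _ ⟨x, rfl⟩
        exact ⟨_, orbitMap_translate ρ v x g⟩ }
  rcases hρ.eq_bot_or_eq_top U with hU | hU
  · exfalso
    apply hv
    have : v ∈ U := ⟨_, orbitMap_single ρ v⟩
    rw [hU] at this
    exact this
  · exact congrArg Subrepresentation.toSubmodule hU

/-- Frobenius reciprocity for monomial characters of nilpotent groups. -/
theorem exists_multiplicity_eq [Group.IsNilpotent E] {θ : E → ℂ} (hθ : IsIrrChar θ) :
    ∃ (H : Subgroup E) (lam : H →* ℂ), ∀ φ : E → ℂ, IsChar φ →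
      (Nat.card E : ℂ)⁻¹ * ∑ g, φ g * θ g⁻¹ = ∑ g, φ g * idemFun lam g := by
  classical
  have h1 := hθ.one_ne_zero
  obtain ⟨d, ρ, hρ, rfl⟩ := hθ
  have hd : (d : ℂ) ≠ 0 := by simpa using h1
  have : Nonempty (Fin d) := ⟨⟨0, Nat.pos_of_ne_zero (by exact_mod_cast hd)⟩⟩
  obtain ⟨H, v, lam, hv0, hv, hind⟩ := exists_eigenline ρ
  refine ⟨H, lam, ?_⟩
  rintro _ ⟨e, σ, rfl⟩
  have hcE : (Nat.card E : ℂ) ≠ 0 := Nat.cast_ne_zero.2 Nat.card_pos.ne'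
  have hcH : (Nat.card H : ℂ) ≠ 0 := Nat.cast_ne_zero.2 Nat.card_pos.ne'
  let _ : Invertible (Nat.card E : ℂ) := invertibleOfNonzero hcE
  let _ : Invertible (Nat.card H : ℂ) := invertibleOfNonzero hcH
  have hAs := orbitMap_surjective ρ hρ hv0
  let σH : Representation ℂ H (Fin e → ℂ) := σ.comp H.subtype
  -- Both sides of the claim are dimensions of Hom spaces; evaluation at v identifies Hom over E
  -- from ρ with Hom over H from λ.
  let L : Representation.IntertwiningMap ρ σ →ₗ[ℂ]
      Representation.IntertwiningMap (lamRep lam) σH :=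
    { toFun := fun F => ⟨LinearMap.toSpanSingleton ℂ _ (F v), fun h => by
        refine LinearMap.ext_ring ?_
        simp only [LinearMap.comp_apply, lamRep_apply, mul_one, LinearMap.toSpanSingleton_apply,
          one_smul]
        have := Representation.IntertwiningMap.isIntertwining ρ σ F h v
        rw [hv, map_smul] at this
        exact this⟩
      map_add' := fun F F' => by
        apply Representation.IntertwiningMap.ext
        refine LinearMap.ext_ring ?_
        simp
      map_smul' := fun c F => by
        apply Representation.IntertwiningMap.ext
        refine LinearMap.ext_ring ?_
        simp }
  have hLv : ∀ F, L F 1 = F v := fun F => by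
    change LinearMap.toSpanSingleton ℂ _ (F v) 1 = F v
    simp
  have hL : Function.Bijective L := by
    constructor
    · rw [injective_iff_map_eq_zero]
      intro F hF
      have hFv : F v = 0 := by rw [← hLv, hF]; rfl
      apply Representation.IntertwiningMap.ext
      refine LinearMap.ext fun y => ?_
      obtain ⟨x, rfl⟩ := hAs y
      change F (orbitMap ρ v x) = 0
      rw [orbitMap_apply, map_sum]
      refine Finset.sum_eq_zero fun g _ => ?_
      rw [map_smul, Representation.IntertwiningMap.isIntertwining, hFv, map_zero, smul_zero]
    · intro F'
      set w := F' 1 with hw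
      have hσw : ∀ h : H, σ h w = lam h • w := fun h => by
        have := Representation.IntertwiningMap.isIntertwining _ _ F' h 1
        rw [lamRep_apply, ← smul_eq_mul, map_smul] at this
        exact this.symm
      obtain ⟨s, hs⟩ := (orbitMap ρ v).exists_rightInverse_of_surjective
        (LinearMap.range_eq_top.2 hAs)
      -- For surjectivity, w must satisfy every linear relation satisfied by the translates of v.
      -- Such a relation has vanishing λ-weighted sums over each coset of H, and w is a
      -- λ-eigenvector.
      have hker : ∀ x, orbitMap ρ v x = 0 → orbitMap σ w x = 0 := fun x hx => by
        have h2 := hind x (by rw [← orbitMap_apply, hx])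
        rw [orbitMap_apply]
        have h3 : (Nat.card H : ℂ) • ∑ g, x g • σ g w =
            ∑ g, (∑ h : H, x (g * h) * lam h) • σ g w := by
          simp only [Finset.sum_smul]
          rw [Finset.sum_comm, Nat.card_eq_fintype_card, ← Finset.card_univ, Nat.cast_smul_eq_nsmul,
            ← Finset.sum_const]
          refine Finset.sum_congr rfl fun h _ => ?_
          refine (Fintype.sum_equiv (Equiv.mulRight (h : E)) _ _ fun g => ?_).symm
          rw [mul_smul, ← map_smul, ← hσw, Equiv.coe_mulRight, map_mul]
          rfl
        simp only [h2, zero_smul, Finset.sum_const_zero] at h3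
        exact (smul_eq_zero.1 h3).resolve_left hcH
      have hφ : ∀ x, orbitMap σ w (s (orbitMap ρ v x)) = orbitMap σ w x := fun x => by
        rw [← sub_eq_zero, ← map_sub]
        apply hker
        rw [map_sub, sub_eq_zero]
        exact LinearMap.congr_fun hs _
      let F : Representation.IntertwiningMap ρ σ := ⟨orbitMap σ w ∘ₗ s, fun g => by
        refine LinearMap.ext fun y => ?_
        obtain ⟨x, rfl⟩ := hAs y
        simp only [LinearMap.comp_apply]
        rw [← orbitMap_translate, hφ, hφ, orbitMap_translate]⟩
      refine ⟨F, ?_⟩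
      apply Representation.IntertwiningMap.ext
      refine LinearMap.ext_ring ?_
      change L F 1 = F' 1
      rw [hLv, ← hw]
      change orbitMap σ w (s v) = w
      conv_lhs => rw [← orbitMap_single ρ v]
      rw [hφ, orbitMap_single]
  rw [Representation.card_inv_mul_sum_char_mul_char_eq_finrank, sum_mul_idemFun]
  have h2 := Representation.card_inv_mul_sum_char_mul_char_eq_finrank (lamRep lam) σH
  rw [character_lamRep] at h2
  rw [(LinearEquiv.ofBijective L hL).finrank_eq, ← h2]
  rfl

/-- A character of a nilpotent group all of whose multiplicities of linear characters of subgroups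
are divisible by `l` is `l` times a generalized character. -/
theorem exists_smul_of_forall_dvd [Group.IsNilpotent E] {χ : E → ℂ} (hχ : IsChar χ) (l : ℕ)
    (h : ∀ (H : Subgroup E) (lam : H →* ℂ), ∃ m : ℕ, ∑ g, χ g * idemFun lam g = (l * m : ℕ)) :
    ∃ φ ∈ charSpan E, χ = (l : ℂ) • φ := by
  classical
  obtain ⟨s, hs, hχs⟩ := hχ.exists_multiset
  have hcE : (Nat.card E : ℂ) ≠ 0 := Nat.cast_ne_zero.2 Nat.card_pos.ne'
  have hdec : χ = ∑ θ ∈ s.toFinset, (s.count θ : ℂ) • θ := by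
    rw [hχs, Finset.sum_multiset_count]
    exact Finset.sum_congr rfl fun θ _ => (Nat.cast_smul_eq_nsmul ℂ _ _).symm
  have hcount : ∀ θ ∈ s.toFinset, ∃ m : ℕ, s.count θ = l * m := by
    intro θ hθ
    have hθi := hs θ (Multiset.mem_toFinset.1 hθ)
    -- Monomiality turns the multiplicity of θ into that of a linear character, where the
    -- divisibility is assumed.
    obtain ⟨H, lam, hHl⟩ := exists_multiplicity_eq hθi
    obtain ⟨m, hm⟩ := h H lam
    refine ⟨m, ?_⟩
    rw [← hHl χ hχ, inv_mul_eq_iff_eq_mul₀ hcE] at hm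
    have h1 : ∑ g, χ g * θ g⁻¹ = (Nat.card E : ℂ) * s.count θ := by
      conv_lhs => rw [hdec]
      simp only [Finset.sum_apply, Pi.smul_apply, smul_eq_mul, Finset.sum_mul, mul_assoc]
      rw [Finset.sum_comm, Finset.sum_eq_single θ]
      · rw [← Finset.mul_sum, hθi.sum_mul hθi, if_pos rfl, mul_comm]
      · intro ψ hψ hne
        rw [← Finset.mul_sum, (hs ψ (Multiset.mem_toFinset.1 hψ)).sum_mul hθi, if_neg hne, mul_zero]
      · exact fun h => absurd hθ h
    rw [h1] at hm
    exact_mod_cast mul_left_cancel₀ hcE hm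
  have hcount' : ∀ θ, ∃ m : ℕ, θ ∈ s.toFinset → s.count θ = l * m := fun θ => by
    by_cases hθ : θ ∈ s.toFinset
    · exact (hcount θ hθ).imp fun m hm _ => hm
    · exact ⟨0, fun h => absurd h hθ⟩
  choose m hm using hcount'
  refine ⟨∑ θ ∈ s.toFinset, (m θ : ℂ) • θ, sum_mem fun θ hθ => smul_mem_charSpan
    (hs θ (Multiset.mem_toFinset.1 hθ)).isChar.mem_charSpan (natCast_mem _ _), ?_⟩
  conv_lhs => rw [hdec]
  rw [Finset.smul_sum]
  refine Finset.sum_congr rfl fun θ hθ => ?_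
  rw [hm θ hθ, smul_smul]
  push_cast
  rfl

end Monomial

end CharacterFields

namespace CharacterFields

/-! ### Elementary subgroups and multiplicities prime to a given prime. -/

section Elementary

variable {G : Type*} [Group G]

theorem isNilpotent_of_isMulCommutative {E : Type*} [Group E] (h : ∀ a b : E, a * b = b * a) :
    Group.IsNilpotent E :=
  ⟨1, by
    rw [Subgroup.upperCentralSeries_one, eq_top_iff]
    exact fun a _ => Subgroup.mem_center_iff.2 fun b => h b a⟩

theorem isNilpotent_zpowers_sup [Finite G] {p : ℕ} [Fact p.Prime] {x : G} {P : Subgroup G}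
    (hP : IsPGroup p P) (hPC : P ≤ Subgroup.centralizer {x}) :
    Group.IsNilpotent ↥(Subgroup.zpowers x ⊔ P) := by
  have h1 : Group.IsNilpotent (Subgroup.zpowers x) := isNilpotent_of_isMulCommutative (by
    rintro ⟨_, a, rfl⟩ ⟨_, b, rfl⟩
    exact Subtype.ext (zpow_mul_comm x a b))
  have h2 : Group.IsNilpotent P := hP.isNilpotent
  have hcomm : ∀ (a : Subgroup.zpowers x) (b : P), Commute (a : G) b := by
    rintro ⟨_, a, rfl⟩ ⟨u, hu⟩
    have : Commute x u := (Subgroup.mem_centralizer_singleton_iff.1 (hPC hu)).symm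
    exact this.zpow_left a
  let f : Subgroup.zpowers x × P →* G := MonoidHom.noncommCoprod
    (Subgroup.zpowers x).subtype P.subtype hcomm
  have hf : f.range = Subgroup.zpowers x ⊔ P := by
    refine (MonoidHom.noncommCoprod_range _ _ hcomm).trans ?_
    rw [Subgroup.range_subtype, Subgroup.range_subtype]
  rw [← hf]
  exact Group.nilpotent_of_surjective f.rangeRestrict f.rangeRestrict_surjective

theorem exists_map_idemFun [Fintype G] {k : Type*} [Field k] {E : Subgroup G} [Fintype E]
    {H : Subgroup E}
    (lam : H →* k) : ∃ (H' : Subgroup G) (lam' : H' →* k), H' ≤ E ∧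
      ∀ φ : G → k, ∑ g, φ g * idemFun lam' g = ∑ e : E, φ e * idemFun lam e := by
  classical
  let e := H.equivMapOfInjective E.subtype E.subtype_injective
  refine ⟨H.map E.subtype, lam.comp e.symm.toMonoidHom, Subgroup.map_subtype_le _, fun φ => ?_⟩
  rw [sum_mul_idemFun, sum_mul_idemFun lam (fun e : E => φ e), Nat.card_congr e.toEquiv]
  congr 1
  refine (Fintype.sum_equiv e.toEquiv _ _ fun h => ?_).symm
  simp only [MulEquiv.toEquiv_eq_coe, EquivLike.coe_coe, MonoidHom.comp_apply]
  congr 2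
  change h⁻¹ = e.symm (e h)⁻¹
  rw [← map_inv, MulEquiv.symm_apply_apply]

theorem exists_restrict_eq_smul [Fintype G] {χ : G → ℂ} (hχ : IsChar χ) (l : ℕ) (E : Subgroup G)
    [Group.IsNilpotent E]
    (h : ∀ (H : Subgroup G) (lam : H →* ℂ), H ≤ E →
      ∃ m : ℕ, ∑ g, χ g * idemFun lam g = (l * m : ℕ)) :
    ∃ φ ∈ charSpan E, ∀ e : E, χ e = l * φ e := by
  classical
  obtain ⟨φ, hφ, hφe⟩ := exists_smul_of_forall_dvd (hχ.comp E.subtype) l fun H lam => by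
    obtain ⟨H', lam', hle, hs⟩ := exists_map_idemFun lam
    obtain ⟨m, hm⟩ := h H' lam' hle
    exact ⟨m, by rw [← hm, hs]; rfl⟩
  exact ⟨φ, hφ, fun e => congrFun hφe e⟩

/-- A character of `p`-height zero has a linear constituent of multiplicity prime to `p` on some
`p'`-subgroup. -/
theorem exists_multiplicity_not_dvd_of_height_zero [Fintype G] {p : ℕ} [Fact p.Prime]
    {M : Ideal AlgInt} (hM : M.IsPrime) (hpM : (p : AlgInt) ∈ M) {χ : G → ℂ} (hχ : IsIrrChar χ)
    (h0 : charHeight p M χ = 0) : ∃ (H : Subgroup G) (lam : H →* ℂ), p.Coprime (Nat.card H) ∧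
      ¬ ∃ m : ℕ, ∑ g, χ g * idemFun lam g = (p * m : ℕ) := by
  obtain ⟨x, hx, hχx⟩ := exists_regular_not_dvd hM hpM hχ h0
  by_contra hcon
  push Not at hcon
  have hnil : Group.IsNilpotent (Subgroup.zpowers x) := isNilpotent_of_isMulCommutative (by
    rintro ⟨_, a, rfl⟩ ⟨_, b, rfl⟩
    exact Subtype.ext (zpow_mul_comm x a b))
  -- Otherwise χ restricted to the p'-group ⟨x⟩ is p times a generalized character, and p divides
  -- χ(x).
  obtain ⟨φ, hφ, h⟩ := exists_restrict_eq_smul hχ.isChar p (Subgroup.zpowers x)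
    fun H lam hle => hcon H lam (by
      refine Nat.Coprime.coprime_dvd_right (Subgroup.card_dvd_of_le hle) ?_
      rwa [Nat.card_zpowers])
  exact hχx ⟨_, apply_mem_algInt hφ ⟨x, Subgroup.mem_zpowers x⟩, h ⟨x, Subgroup.mem_zpowers x⟩⟩

/-- Frobenius reciprocity: the section function behaves as if induced from the normalized indicator
of the coset xP. -/
theorem sum_mul_sectionFun [Fintype G] (x : G) (P : Subgroup G) [Fintype P] (Ψ : G → ℂ)
    (hΨ : ∀ t g, Ψ (t * g * t⁻¹) = Ψ g) :
    (Nat.card G : ℂ)⁻¹ * ∑ g, Ψ g * sectionFun x P g =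
      (Fintype.card P : ℂ)⁻¹ * ∑ u : P, Ψ (x * u) := by
  classical
  have hG : (Nat.card G : ℂ) ≠ 0 := Nat.cast_ne_zero.2 Nat.card_pos.ne'
  have h1 : ∀ g, Ψ g * sectionFun x P g =
      (Fintype.card P : ℂ)⁻¹ * ∑ t, if x⁻¹ * (t⁻¹ * g * t) ∈ P then Ψ g else 0 := fun g => by
    rw [sectionFun, Nat.card_eq_fintype_card, ← Finset.sum_filter, Finset.sum_const, nsmul_eq_mul]
    rw [mul_comm, mul_assoc]
  have h2 : ∀ t : G, (∑ g, if x⁻¹ * (t⁻¹ * g * t) ∈ P then Ψ g else 0) = ∑ u : P, Ψ (x * u) := by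
    intro t
    have h3 : ∑ u : P, Ψ (x * u) = ∑ g, if g ∈ P then Ψ (x * g) else 0 := by
      rw [← Finset.sum_filter]
      exact (Finset.sum_subtype (p := fun g => g ∈ P) (F := ‹_›) (Finset.univ.filter (· ∈ P))
        (by simp) (fun g => Ψ (x * g))).symm
    rw [h3]
    refine (Fintype.sum_equiv ((Equiv.mulLeft x).trans (MulAut.conj t).toEquiv) _ _ fun g => ?_).symm
    have h4 : x⁻¹ * (t⁻¹ * (t * (x * g) * t⁻¹) * t) = g := by group
    simp only [Equiv.trans_apply, Equiv.coe_mulLeft, MulEquiv.toEquiv_eq_coe, EquivLike.coe_coe,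
      MulAut.conj_apply, h4, hΨ]
  simp_rw [h1]
  rw [← Finset.mul_sum, Finset.sum_comm, Finset.sum_congr rfl fun t _ => h2 t, Finset.sum_const,
    Finset.card_univ, ← Nat.card_eq_fintype_card (α := G), nsmul_eq_mul, mul_left_comm,
    inv_mul_cancel_left₀ hG]

theorem dvd_of_natCast_eq_mul {l n : ℕ} (hl : l ≠ 0) {y : ℂ} (hy : y ∈ AlgInt)
    (h : (n : ℂ) = l * y) : l ∣ n := by
  have hl' : (l : ℂ) ≠ 0 := Nat.cast_ne_zero.2 hl
  have hy' : y = algebraMap ℚ ℂ (n / l) := by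
    rw [map_div₀, map_natCast, map_natCast, h, mul_div_cancel_left₀ _ hl']
  have hy : IsIntegral ℤ y := hy
  rw [hy', isIntegral_algebraMap_iff (algebraMap ℚ ℂ).injective] at hy
  obtain ⟨m, hm⟩ := IsIntegrallyClosed.isIntegral_iff.1 hy
  have hlQ : (l : ℚ) ≠ 0 := Nat.cast_ne_zero.2 hl
  have : ((n : ℤ) : ℚ) = ((l * m : ℤ) : ℚ) := by
    push_cast
    rw [eq_div_iff hlQ] at hm
    rw [← hm, mul_comm]
    rfl
  exact Int.natCast_dvd_natCast.1 ⟨m, by exact_mod_cast this⟩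

/-- By reciprocity the left side is the average over xP of g ↦ χ(g)χ(g⁻¹)θ(g). On the nilpotent
group ⟨x⟩P the hypothesis makes χ equal to l times a generalized character, and averaging over the
normal subgroup P stays among generalized characters, whose values are integral. -/
theorem exists_sum_mul_eq [Fintype G] {l : ℕ} [Fact l.Prime] {χ : G → ℂ} (hχ : IsIrrChar χ)
    (h : ∀ (H : Subgroup G) (lam : H →* ℂ), ∃ m : ℕ, ∑ g, χ g * idemFun lam g = (l * m : ℕ))
    {x : G} {P : Subgroup G} (hP : IsPGroup l P) (hPC : P ≤ Subgroup.centralizer {x})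
    {θ : G → ℂ} (hθ : θ ∈ charSpan G) :
    ∃ y ∈ AlgInt, (Nat.card G : ℂ)⁻¹ * ∑ g, χ g * χ g⁻¹ * θ g * sectionFun x P g = l * y := by
  classical
  have hχ' := hχ.isChar.mem_charSpan
  have hχi := hχ.isChar.inv.mem_charSpan
  let E := Subgroup.zpowers x ⊔ P
  have hxE : x ∈ E := Subgroup.mem_sup_left (Subgroup.mem_zpowers x)
  have hPE : P ≤ E := le_sup_right
  have hnil : Group.IsNilpotent E := isNilpotent_zpowers_sup hP hPC
  obtain ⟨φ, hφ, hφe⟩ := exists_restrict_eq_smul hχ.isChar l E fun H lam _ => h H lam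
  have hΨ := mul_mem_charSpan (mul_mem_charSpan hχ' hχi) hθ
  have key := sum_mul_sectionFun x P _ (conj_of_mem_charSpan hΨ)
  simp only [Pi.mul_apply] at key
  rw [key]
  have hPn : (P.subgroupOf E).Normal := by
    refine Subgroup.normal_subgroupOf_of_le_normalizer (sup_le ?_ Subgroup.le_normalizer)
    refine le_trans ?_ (Subgroup.centralizer_le_normalizer (P : Set G))
    rw [Subgroup.zpowers_le, Subgroup.mem_centralizer_iff]
    exact fun u hu => Subgroup.mem_centralizer_singleton_iff.1 (hPC hu)
  have hmem := average_mem_charSpan (mul_mem_charSpan (mul_mem_charSpan hφ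
    (comp_mem_charSpan hχi E.subtype)) (comp_mem_charSpan hθ E.subtype)) (P.subgroupOf E)
  refine ⟨_, apply_mem_algInt hmem ⟨x, hxE⟩, ?_⟩
  have e : P.subgroupOf E ≃ P := (Subgroup.subgroupOfEquivOfLe hPE).toEquiv
  rw [Fintype.card_congr e, mul_left_comm]
  congr 1
  rw [Finset.mul_sum]
  refine (Fintype.sum_equiv (Subgroup.subgroupOfEquivOfLe hPE).toEquiv _ _ fun u => ?_).symm
  have h1 : (((Subgroup.subgroupOfEquivOfLe hPE).toEquiv u : P) : G) = ((u : E) : G) := rfl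
  rw [h1]
  have h2 := hφe (⟨x, hxE⟩ * u)
  simp only [Subgroup.coe_mul] at h2
  rw [h2]
  simp only [Pi.mul_apply, Subgroup.coe_subtype, Subgroup.coe_mul]
  ring

/-- An irreducible character has, for each prime `l`, a linear constituent on some subgroup with
multiplicity prime to `l`. -/
theorem exists_multiplicity_not_dvd [Fintype G] {l : ℕ} [Fact l.Prime] {χ : G → ℂ}
    (hχ : IsIrrChar χ) : ∃ (H : Subgroup G) (lam : H →* ℂ),
      ¬ ∃ m : ℕ, ∑ g, χ g * idemFun lam g = (l * m : ℕ) := by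
  classical
  have hl : l.Prime := Fact.out
  by_contra hcon
  push Not at hcon
  choose P hP hPC hPi using exists_centralizer_sylow (G := G) l
  have hxP : ∀ x, ∀ u ∈ P x, x * u = u * x := fun x u hu =>
    (Subgroup.mem_centralizer_singleton_iff.1 (hPC x hu)).symm
  obtain ⟨a, n', hn', hG⟩ := Nat.exists_eq_pow_mul_and_not_dvd
    (Nat.card_pos (α := G)).ne' l hl.ne_one
  have hGne : (Nat.card G : ℂ) ≠ 0 := Nat.cast_ne_zero.2 Nat.card_pos.ne'
  obtain ⟨k, hk⟩ : ∃ k, Nat.totient (l ^ (a + 1)) = k + 1 :=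
    Nat.exists_eq_succ_of_ne_zero (Nat.totient_pos.2 (pow_pos hl.pos _)).ne'
  let f : G → G → ℂ := fun x => sectionFun x (P x)
  have hf : ∀ x, f x ∈ charSpan G := fun x => sectionFun_mem_charSpan x (P x) (hxP x)
  have hpow : ∀ φ ∈ charSpan G, ∀ j, φ ^ j ∈ charSpan G := fun φ hφ j => by
    induction j with
    | zero => rw [pow_zero]; exact one_mem_charSpan
    | succ j ih => rw [pow_succ]; exact mul_mem_charSpan ih hφ
  -- J(θ) is the inner product of χθ with χ, so J(1) = 1. By `exists_sum_mul_eq`, J is divisible by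
  -- l on multiples of each f(x), so J(1) is congruent modulo l to J of the product of the 1 -
  -- f(x)^(k+1).
  let J : (G → ℂ) → ℂ := fun θ => (Nat.card G : ℂ)⁻¹ * ∑ g, χ g * χ g⁻¹ * θ g
  have hJ : ∀ S : Finset G, (∏ x ∈ S, (1 - f x ^ (k + 1))) ∈ charSpan G ∧
      ∃ y ∈ AlgInt, J 1 = J (∏ x ∈ S, (1 - f x ^ (k + 1))) + l * y := by
    intro S
    induction S using Finset.induction_on with
    | empty => exact ⟨one_mem_charSpan, 0, zero_mem _, by simp⟩
    | insert x S hx ih =>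
      obtain ⟨hmem, y, hy, hye⟩ := ih
      rw [Finset.prod_insert hx]
      set Q := ∏ x ∈ S, (1 - f x ^ (k + 1)) with hQ
      refine ⟨mul_mem_charSpan (sub_mem one_mem_charSpan (hpow _ (hf x) _)) hmem, ?_⟩
      obtain ⟨y', hy', hye'⟩ := exists_sum_mul_eq hχ hcon (hP x) (hPC x)
        (mul_mem_charSpan (hpow _ (hf x) k) hmem)
      refine ⟨y + y', add_mem hy hy', ?_⟩
      rw [hye, mul_add, ← hye']
      simp only [J]
      rw [add_comm (l * y), ← add_assoc, ← mul_add, ← Finset.sum_add_distrib]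
      congr 2
      refine Finset.sum_congr rfl fun g _ => ?_
      simp only [Pi.mul_apply, Pi.sub_apply, Pi.one_apply, Pi.pow_apply, f]
      ring
  let S : Finset G := Finset.univ.filter fun x => l.Coprime (orderOf x)
  obtain ⟨hmem, y, hy, hye⟩ := hJ S
  set Q := ∏ x ∈ S, (1 - f x ^ (k + 1)) with hQ
  have hJ1 : J 1 = 1 := by
    simp only [J, Pi.one_apply, mul_one]
    rw [hχ.sum_mul hχ, if_pos rfl, inv_mul_cancel₀ hGne]
  -- On the section of x the value of f(x) is an integer prime to l, and k + 1 is the totient of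
  -- l^(a+1), so Euler's theorem applies. As l^a is the l-part of |G|, the exponent a + 1 leaves a
  -- factor l after division by |G|.
  have hQg : ∀ g, ∃ w ∈ AlgInt, Q g = (l ^ (a + 1) : ℕ) * w := by
    intro g
    obtain ⟨x, v, hg, hxv, hx, j, hv⟩ := exists_regular_mul_primary l g
    have hxS : x ∈ S := Finset.mem_filter.2 ⟨Finset.mem_univ _, hx⟩
    obtain ⟨n, hn, hnl⟩ := sectionFun_mul_primary hx (hP x) (hPC x) (hPi x) hxv hv
    rw [← hg] at hn
    have hmod : ((l ^ (a + 1) : ℕ) : ℤ) ∣ 1 - (n : ℤ) ^ (k + 1) := by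
      have := Nat.ModEq.pow_totient (((Nat.coprime_comm.1
        ((hl.coprime_iff_not_dvd).2 hnl)).pow_right (a + 1)))
      rw [hk] at this
      have := (Nat.modEq_iff_dvd.1 this)
      push_cast at this ⊢
      exact this
    obtain ⟨c, hc⟩ := hmod
    rw [hQ, ← Finset.mul_prod_erase S _ hxS, Pi.mul_apply]
    refine ⟨c * (∏ x ∈ S.erase x, (1 - f x ^ (k + 1))) g,
      mul_mem (intCast_mem _ c) (apply_mem_algInt (hJ _).1 g), ?_⟩
    have h1 : (1 - f x ^ (k + 1)) g = (((1 - (n : ℤ) ^ (k + 1) : ℤ)) : ℂ) := by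
      simp only [Pi.sub_apply, Pi.one_apply, Pi.pow_apply, f, hn]
      push_cast
      rfl
    rw [h1, hc]
    push_cast
    ring
  choose w hw hQw using hQg
  have hχint := hχ.isChar.mem_algInt
  have h2 : (n' : ℂ) * J Q = l * ∑ g, χ g * χ g⁻¹ * w g := by
    simp only [J]
    have h3 : ∑ g, χ g * χ g⁻¹ * Q g = (l ^ (a + 1) : ℕ) * ∑ g, χ g * χ g⁻¹ * w g := by
      rw [Finset.mul_sum]
      exact Finset.sum_congr rfl fun g _ => by rw [hQw]; ring
    rw [h3]
    have h4 : (Nat.card G : ℂ) = (l : ℂ) ^ a * n' := by rw [hG]; push_cast; rfl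
    rw [← mul_assoc, ← mul_assoc, ← mul_right_inj' hGne]
    push_cast
    have h5 : (n' : ℂ) * (Nat.card G : ℂ)⁻¹ * l ^ (a + 1) = l := by
      rw [mul_right_comm, mul_inv_eq_iff_eq_mul₀ hGne, h4]
      ring
    rw [h5]
  rw [hJ1] at hye
  refine hn' (dvd_of_natCast_eq_mul hl.ne_zero
    (y := ∑ g, χ g * χ g⁻¹ * w g + n' * y) (add_mem (sum_mem fun g _ =>
      mul_mem (mul_mem (hχint _) (hχint _)) (hw g)) (mul_mem (natCast_mem _ _) hy)) ?_)
  linear_combination (n' : ℂ) * hye + h2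

end Elementary

end CharacterFields

namespace CharacterFields

/-! ### Homogeneous representations and their dimensions. -/

section Homogeneous

variable {k : Type*} [Field k] {G : Type*} [Group G] {χ : G → k}

/-- The class sums act on the representation by the scalars prescribed by `χ`. -/
def IsHomogeneous [Fintype G] (χ : G → k) {V : Type*} [AddCommGroup V] [Module k V]
    (σ : Representation k G V) : Prop :=
  ∀ g, ∑ t, σ (t * g * t⁻¹) = (Nat.card G * χ g / χ 1) • (1 : End k V)

section Theory

variable [Fintype G] {V : Type*} [AddCommGroup V] [Module k V] {σ : Representation k G V}

theorem IsHomogeneous.character_eq [CharZero k] [FiniteDimensional k V] (h : IsHomogeneous χ σ)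
    (g : G) : σ.character g = finrank k V / χ 1 * χ g := by
  have h1 := congrArg (LinearMap.trace k V) (h g)
  rw [map_sum, map_smul, LinearMap.trace_one] at h1
  change ∑ t, σ.character (t * g * t⁻¹) = _ at h1
  simp only [Representation.char_conj, Finset.sum_const, Finset.card_univ,
    nsmul_eq_mul, ← Nat.card_eq_fintype_card] at h1
  have hG : (Nat.card G : k) ≠ 0 := Nat.cast_ne_zero.2 Nat.card_pos.ne'
  rw [smul_eq_mul] at h1
  refine mul_left_cancel₀ hG (h1.trans ?_)
  ring

theorem IsHomogeneous.toRepresentation (h : IsHomogeneous χ σ) (U : Subrepresentation σ) :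
    IsHomogeneous χ U.toRepresentation := fun g => by
  ext v
  have := LinearMap.congr_fun (h g) v
  simp only [LinearMap.sum_apply, LinearMap.smul_apply, Module.End.one_apply, Submodule.coe_sum,
    Submodule.coe_smul] at this ⊢
  exact this

end Theory

variable [Algebra k ℂ]

theorem map_one_ne_zero (hχ : IsIrrChar fun g => algebraMap k ℂ (χ g)) : χ 1 ≠ 0 := fun h =>
  hχ.one_ne_zero (by rw [h, map_zero])

theorem map_one_eq (hχ : IsIrrChar fun g => algebraMap k ℂ (χ g)) :
    χ 1 = charDegree fun g => algebraMap k ℂ (χ g) :=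
  (algebraMap k ℂ).injective (by rw [map_natCast]; exact hχ.isChar.charDegree_eq)

theorem map_conj (hχ : IsIrrChar fun g => algebraMap k ℂ (χ g)) (t g : G) :
    χ (t * g * t⁻¹) = χ g := by
  obtain ⟨d, ρ, -, h⟩ := hχ
  have h := congrFun h
  refine (algebraMap k ℂ).injective ?_
  rw [← h, ← h, Representation.char_conj]

variable [Fintype G]

theorem sum_mul_map_inv (hχ : IsIrrChar fun g => algebraMap k ℂ (χ g)) :
    ∑ g, χ g * χ g⁻¹ = Nat.card G := by
  refine (algebraMap k ℂ).injective ?_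
  rw [map_natCast, ← (hχ.sum_mul hχ).trans (if_pos rfl), map_sum]
  simp only [map_mul]

/-- Over ℂ this is Schur's lemma for class sums; the identity descends to k by injectivity of the
embedding. -/
theorem sum_map_mul_conj (hχ : IsIrrChar fun g => algebraMap k ℂ (χ g)) (g h : G) :
    ∑ t, χ (t * g * t⁻¹ * h) = Nat.card G * χ g / χ 1 * χ h := by
  have h1 := hχ.one_ne_zero
  refine (algebraMap k ℂ).injective ?_
  rw [map_sum, map_mul, map_div₀, map_mul, map_natCast]
  generalize hψ : (fun g => algebraMap k ℂ (χ g)) = ψ at *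
  have hψ : ∀ g, algebraMap k ℂ (χ g) = ψ g := fun g => congrFun hψ g
  simp only [hψ]
  obtain ⟨d, ρ, hρ, rfl⟩ := hχ
  obtain ⟨c, hc⟩ := exists_smul_one_of_commute ρ (∑ t, ρ (t * g * t⁻¹)) fun s => by
    rw [Finset.mul_sum, Finset.sum_mul]
    refine Fintype.sum_equiv (Equiv.mulLeft s) _ _ fun t => ?_
    rw [Equiv.coe_mulLeft, ← map_mul, ← map_mul]
    congr 1
    group
  have htr : ∀ h, ∑ t, ρ.character (t * g * t⁻¹ * h) = c * ρ.character h := fun h => by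
    simp only [Representation.character, map_mul ρ _ h]
    rw [← map_sum, ← Finset.sum_mul, hc, smul_mul_assoc, one_mul, map_smul, smul_eq_mul]
  have h2 := htr 1
  simp only [mul_one, Representation.char_conj, Finset.sum_const, Finset.card_univ,
    nsmul_eq_mul, ← Nat.card_eq_fintype_card] at h2
  rw [hψ] at h1
  rw [htr, h2, mul_div_cancel_right₀ _ h1]

/-- Both characters are multiples of χ, which has norm one. In particular nonzero homogeneous
representations always have nonzero maps between them. -/
theorem IsHomogeneous.finrank_intertwiningMap [CharZero k]
    {V W : Type*} [AddCommGroup V] [Module k V] [AddCommGroup W] [Module k W]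
    {σ : Representation k G V} {τ : Representation k G W}
    (hχ : IsIrrChar fun g => algebraMap k ℂ (χ g))
    [FiniteDimensional k V] [FiniteDimensional k W] (hσ : IsHomogeneous χ σ)
    (hτ : IsHomogeneous χ τ) :
    (finrank k (Representation.IntertwiningMap σ τ) : k) * χ 1 ^ 2 =
      finrank k V * finrank k W := by
  have hG : (Nat.card G : k) ≠ 0 := Nat.cast_ne_zero.2 Nat.card_pos.ne'
  have h1 := map_one_ne_zero hχ
  let _ : Invertible (Nat.card G : k) := invertibleOfNonzero hG
  rw [← Representation.card_inv_mul_sum_char_mul_char_eq_finrank]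
  have : ∀ g, τ.character g * σ.character g⁻¹ =
      (finrank k V / χ 1 * (finrank k W / χ 1)) * (χ g * χ g⁻¹) := fun g => by
    rw [hσ.character_eq, hτ.character_eq]; ring
  rw [Finset.sum_congr rfl fun g _ => this g, ← Finset.mul_sum, sum_mul_map_inv hχ]
  field_simp

/-- The endomorphism ring has dimension (dim V / χ(1))², which is at least 1, so dim V ≥ χ(1);
divisibility gives the reverse inequality. -/
theorem IsHomogeneous.character_eq_of_finrank_dvd [CharZero k] (hχ : IsIrrChar fun g => algebraMap k ℂ (χ g)) {V : Type*}
    [AddCommGroup V] [Module k V] {σ : Representation k G V} (hσ : IsHomogeneous χ σ)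
    [FiniteDimensional k V] [Nontrivial V]
    (h : finrank k V ∣ charDegree fun g => algebraMap k ℂ (χ g)) : σ.character = χ := by
  have h1 := map_one_ne_zero hχ
  have h2 := hσ.finrank_intertwiningMap hχ hσ
  have hpos : 0 < finrank k V := finrank_pos
  rw [map_one_eq hχ] at h2 h1
  generalize hd : (charDegree fun g => algebraMap k ℂ (χ g)) = d at *
  have hd0 : d ≠ 0 := by rintro rfl; simp at h1
  have h3 : finrank k (Representation.IntertwiningMap σ σ) * d ^ 2 = finrank k V * finrank k V := by
    exact_mod_cast h2
  have h4 : finrank k (Representation.IntertwiningMap σ σ) ≠ 0 := fun h0 => by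
    rw [h0, zero_mul] at h3
    exact (Nat.mul_pos hpos hpos).ne h3
  have h5 : d ≤ finrank k V := by
    rw [← Nat.pow_le_pow_iff_left two_ne_zero, sq (finrank k V), ← h3]
    exact Nat.le_mul_of_pos_left _ (Nat.pos_of_ne_zero h4)
  have h6 := le_antisymm h5 (Nat.le_of_dvd (Nat.pos_of_ne_zero hd0) h)
  funext g
  rw [hσ.character_eq, ← h6, map_one_eq hχ, hd, div_self h1, one_mul]

/-- Minimality stands in for irreducibility of σ: a nonzero map from σ to τ is injective, its image
splits off, and the complement is homogeneous of smaller dimension. -/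
theorem finrank_dvd_of_minimal [CharZero k] (hχ : IsIrrChar fun g => algebraMap k ℂ (χ g))
    {V : Type*} [AddCommGroup V] [Module k V] [FiniteDimensional k V] [Nontrivial V]
    {σ : Representation k G V} (hσ : IsHomogeneous χ σ)
    (hmin : ∀ U : Subrepresentation σ, finrank k U.toSubmodule < finrank k V →
      finrank k U.toSubmodule = 0) (n : ℕ) :
    ∀ {W : Type*} [AddCommGroup W] [Module k W] [FiniteDimensional k W]
      {τ : Representation k G W}, IsHomogeneous χ τ → finrank k W = n → finrank k V ∣ n := by
  induction n using Nat.strong_induction_on with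
  | _ n ih =>
    intro W _ _ _ τ hτ hn
    rcases Nat.eq_zero_or_pos n with rfl | hn0
    · exact dvd_zero _
    have h2 := hσ.finrank_intertwiningMap hχ hτ
    have hV : 0 < finrank k V := finrank_pos
    obtain ⟨f, hf⟩ : ∃ f : Representation.IntertwiningMap σ τ, f ≠ 0 := by
      by_contra hcon
      push Not at hcon
      have : Subsingleton (Representation.IntertwiningMap σ τ) :=
        ⟨fun a b => (hcon a).trans (hcon b).symm⟩
      rw [finrank_zero_of_subsingleton, Nat.cast_zero, zero_mul, eq_comm, mul_eq_zero, hn] at h2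
      norm_cast at h2
      omega
    have hrk := LinearMap.finrank_range_add_finrank_ker f.toLinearMap
    have hker : finrank k f.ker.toSubmodule = 0 := by
      refine hmin _ (lt_of_le_of_ne (Submodule.finrank_le _) fun h => hf ?_)
      have := Submodule.eq_top_of_finrank_eq h
      apply Representation.IntertwiningMap.ext
      exact LinearMap.ker_eq_top.1 this
    change finrank k f.range.toSubmodule + finrank k f.ker.toSubmodule = _ at hrk
    obtain ⟨U', hU, -⟩ := character_eq_add τ f.range
    rw [hker, add_zero] at hrk
    rw [← hn, hU, hrk]
    refine Nat.dvd_add dvd_rfl ?_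
    exact ih _ (by omega) (hτ.toRepresentation U') rfl

end Homogeneous

end CharacterFields

namespace CharacterFields

/-! ### Homogeneous left ideals of the group algebra. -/

section GroupAlgebra

variable {k : Type*} [Field k] {G : Type*} [Group G]

/-- The left regular representation on the group algebra. -/
noncomputable def regRep (k G : Type*) [Field k] [Group G] :
    Representation k G (MonoidAlgebra k G) :=
  ((Algebra.lmul k (MonoidAlgebra k G) :
    MonoidAlgebra k G →ₐ[k] End k (MonoidAlgebra k G)) : _ →* _).comp (MonoidAlgebra.of k G)

theorem regRep_comm (a : MonoidAlgebra k G) (g : G) :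
    regRep k G g ∘ₗ LinearMap.mulRight k a = LinearMap.mulRight k a ∘ₗ regRep k G g :=
  LinearMap.ext fun x => (mul_assoc (MonoidAlgebra.single g 1) x a).symm

variable [Fintype G]

instance : FiniteDimensional k (MonoidAlgebra k G) :=
  Module.Finite.of_basis (MonoidAlgebra.basis G k)

theorem trace_mulRight (a : MonoidAlgebra k G) :
    LinearMap.trace k _ (LinearMap.mulRight k a) = Nat.card G * a.coeff 1 := by
  classical
  rw [LinearMap.trace_eq_matrix_trace k (MonoidAlgebra.basis G k), Matrix.trace]
  have : ∀ g, (LinearMap.toMatrix (MonoidAlgebra.basis G k) (MonoidAlgebra.basis G k)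
      (LinearMap.mulRight k a)).diag g = a.coeff 1 := fun g => by
    rw [Matrix.diag_apply, LinearMap.toMatrix_apply, MonoidAlgebra.basis_apply]
    change (MonoidAlgebra.single g 1 * a).coeff g = _
    rw [MonoidAlgebra.coeff_single_mul_eq_mul_coeff 1 (by simp), one_mul]
  rw [Finset.sum_congr rfl fun g _ => this g, Finset.sum_const, Finset.card_univ, nsmul_eq_mul,
    Nat.card_eq_fintype_card]

/-- The element of the group algebra with the given coefficients. -/
noncomputable def ofFun (φ : G → k) : MonoidAlgebra k G := ∑ g, MonoidAlgebra.single g (φ g)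

omit [Group G] in
theorem coeff_ofFun (φ : G → k) (g : G) : (ofFun φ).coeff g = φ g := by
  classical
  rw [ofFun, MonoidAlgebra.coeff_sum, Finset.sum_apply']
  simp [MonoidAlgebra.coeff_single, Finsupp.single_apply]

theorem coeff_mul_ofFun_one (φ ψ : G → k) :
    (ofFun φ * ofFun ψ).coeff 1 = ∑ g, φ g⁻¹ * ψ g := by
  classical
  rw [ofFun, Finset.sum_mul, MonoidAlgebra.coeff_sum, Finset.sum_apply',
    ← Equiv.sum_comp (Equiv.inv G)]
  refine Finset.sum_congr rfl fun g _ => ?_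
  rw [MonoidAlgebra.coeff_single_mul_eq_mul_coeff g (by simp [inv_mul_eq_iff_eq_mul])]
  simp [coeff_ofFun]

theorem single_mul_ofFun (g : G) (φ : G → k) :
    MonoidAlgebra.single g 1 * ofFun φ = ofFun fun t => φ (g⁻¹ * t) := by
  rw [ofFun, Finset.mul_sum]
  refine Fintype.sum_equiv (Equiv.mulLeft g) _ _ fun t => ?_
  simp [MonoidAlgebra.single_mul_single]

theorem ofFun_mul_single (g : G) (φ : G → k) :
    ofFun φ * MonoidAlgebra.single g 1 = ofFun fun t => φ (t * g⁻¹) := by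
  rw [ofFun, Finset.sum_mul]
  refine Fintype.sum_equiv (Equiv.mulRight g) _ _ fun t => ?_
  simp [MonoidAlgebra.single_mul_single]

theorem ofFun_mul (φ : G → k) (x : MonoidAlgebra k G) :
    ofFun φ * x = ∑ g, φ g • (MonoidAlgebra.single g 1 * x) := by
  rw [ofFun, Finset.sum_mul]
  exact Finset.sum_congr rfl fun g _ => by
    rw [← smul_mul_assoc, MonoidAlgebra.smul_single, smul_eq_mul, mul_one]

theorem ofFun_smul (c : k) (φ : G → k) : ofFun (fun g => c * φ g) = c • ofFun φ := by
  simp [ofFun, Finset.smul_sum]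

theorem ofFun_idemFun_mul_self [CharZero k] {H : Subgroup G} (lam : H →* k) :
    ofFun (idemFun lam) * ofFun (idemFun lam) = ofFun (idemFun lam) := by
  classical
  have hH : (Nat.card H : k) ≠ 0 := Nat.cast_ne_zero.2 Nat.card_pos.ne'
  have h1 : ∀ h : H, MonoidAlgebra.single (h : G) 1 * ofFun (idemFun lam) =
      lam h • ofFun (idemFun lam) := fun h => by
    rw [single_mul_ofFun, ← ofFun_smul]
    congr 1
    funext t
    by_cases ht : t ∈ H
    · have ht' : (h : G)⁻¹ * t ∈ H := H.mul_mem (H.inv_mem h.2) ht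
      rw [idemFun, idemFun, dif_pos ht, dif_pos ht', mul_left_comm, mul_comm (lam h), ← map_mul]
      congr 2
      ext
      simp
    · have ht' : (h : G)⁻¹ * t ∉ H := fun h' => ht (by simpa using H.mul_mem h.2 h')
      rw [idemFun, idemFun, dif_neg ht, dif_neg ht', mul_zero]
  have h2 : ∀ g, idemFun lam g • (MonoidAlgebra.single g 1 * ofFun (idemFun lam)) =
      (if g ∈ H then (Nat.card H : k)⁻¹ else 0) • ofFun (idemFun lam) := fun g => by
    split_ifs with hg
    · rw [h1 ⟨g, hg⟩, smul_smul, idemFun, dif_pos hg, mul_assoc, ← map_mul, inv_mul_cancel,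
        map_one, mul_one]
    · rw [idemFun, dif_neg hg, zero_smul, zero_smul]
  rw [ofFun_mul, Finset.sum_congr rfl fun g _ => h2 g, ← Finset.sum_smul]
  rw [← Finset.sum_filter, Finset.sum_const, nsmul_eq_mul,
    show (Finset.univ.filter (· ∈ H)).card = Nat.card H by
      rw [Nat.card_eq_fintype_card, Fintype.card_subtype], mul_inv_cancel₀ hH, one_smul]

variable [Algebra k ℂ] {χ : G → k}

/-- The central idempotent of the group algebra attached to an irreducible character. -/
noncomputable def centralIdem (χ : G → k) : MonoidAlgebra k G :=
  ofFun fun g => χ 1 / Nat.card G * χ g⁻¹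

theorem single_mul_centralIdem (hχ : IsIrrChar fun g => algebraMap k ℂ (χ g)) (g : G) :
    MonoidAlgebra.single g 1 * centralIdem χ = centralIdem χ * MonoidAlgebra.single g 1 := by
  rw [centralIdem, single_mul_ofFun, ofFun_mul_single]
  congr 1
  funext t
  have := map_conj hχ g (t⁻¹ * g)
  rw [mul_inv_rev, inv_inv, mul_inv_rev, inv_inv, ← this]
  congr 2
  group

theorem sum_conj_mul_centralIdem (hχ : IsIrrChar fun g => algebraMap k ℂ (χ g)) (g : G) :
    ∑ t, MonoidAlgebra.single (t * g * t⁻¹) 1 * centralIdem χ =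
      (Nat.card G * χ g / χ 1) • centralIdem χ := by
  apply MonoidAlgebra.ext
  ext s
  simp only [centralIdem, single_mul_ofFun]
  rw [← ofFun_smul, MonoidAlgebra.coeff_sum, Finset.sum_apply']
  simp only [coeff_ofFun]
  rw [← Finset.mul_sum, mul_left_comm, ← sum_map_mul_conj hχ]
  congr 1
  refine Finset.sum_congr rfl fun t _ => ?_
  have := map_conj hχ s (s⁻¹ * (t * g * t⁻¹))
  rw [mul_inv_rev, inv_inv, ← this]
  congr 1
  group

theorem centralIdem_mul_self [CharZero k] (hχ : IsIrrChar fun g => algebraMap k ℂ (χ g)) :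
    centralIdem χ * centralIdem χ = centralIdem χ := by
  have hG : (Nat.card G : k) ≠ 0 := Nat.cast_ne_zero.2 Nat.card_pos.ne'
  have h1 := map_one_ne_zero hχ
  have h2 : (Nat.card G : k) • (centralIdem χ * centralIdem χ) =
      (Nat.card G : k) • centralIdem χ := by
    -- The coefficients form a class function, so g may be replaced by its conjugate under t;
    -- summing over t then produces class sums, which act on `centralIdem χ` by scalars.
    have h3 : ∀ t : G, centralIdem χ * centralIdem χ = ∑ g, (χ 1 / Nat.card G * χ g⁻¹) •
        (MonoidAlgebra.single (t * g * t⁻¹) 1 * centralIdem χ) := fun t => by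
      conv_lhs => rw [centralIdem, ofFun_mul, ← centralIdem]
      refine (Fintype.sum_equiv (MulAut.conj t).toEquiv _ _ fun g => ?_).symm
      simp only [MulEquiv.toEquiv_eq_coe, EquivLike.coe_coe, MulAut.conj_apply]
      rw [← map_conj hχ t g⁻¹]
      congr 3
      group
    calc (Nat.card G : k) • (centralIdem χ * centralIdem χ)
        = ∑ t : G, centralIdem χ * centralIdem χ := by
          rw [Finset.sum_const, Finset.card_univ, Nat.card_eq_fintype_card, Nat.cast_smul_eq_nsmul]
      _ = ∑ g, (χ 1 / Nat.card G * χ g⁻¹) • ((Nat.card G * χ g / χ 1) • centralIdem χ) := by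
          rw [Finset.sum_congr rfl fun t _ => h3 t, Finset.sum_comm]
          exact Finset.sum_congr rfl fun g _ => by
            rw [← Finset.smul_sum, sum_conj_mul_centralIdem hχ]
      _ = (Nat.card G : k) • centralIdem χ := by
          simp only [smul_smul]
          rw [← Finset.sum_smul]
          congr 1
          refine Eq.trans (Finset.sum_congr rfl fun g _ => ?_) (sum_mul_map_inv hχ)
          field_simp
  exact smul_right_injective _ hG h2

/-- The left ideal generated by e_χ·ε_λ is homogeneous because e_χ is central. Its dimension is the
trace of right multiplication by this idempotent, that is, |G| times the coefficient at 1. -/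
theorem exists_isHomogeneous [CharZero k] (hχ : IsIrrChar fun g => algebraMap k ℂ (χ g)) {H : Subgroup G}
    (lam : H →* k) : ∃ U : Subrepresentation (regRep k G), IsHomogeneous χ U.toRepresentation ∧
      (finrank k U.toSubmodule : k) = χ 1 * ∑ g, χ g * idemFun lam g := by
  have hG : (Nat.card G : k) ≠ 0 := Nat.cast_ne_zero.2 Nat.card_pos.ne'
  have hcomm : ∀ x, x * centralIdem χ = centralIdem χ * x := fun x => by
    rw [sum_single_coeff x, Finset.sum_mul, Finset.mul_sum]
    refine Finset.sum_congr rfl fun g _ => ?_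
    have h : MonoidAlgebra.single g (x.coeff g) = x.coeff g • MonoidAlgebra.single g (1 : k) := by
      rw [MonoidAlgebra.smul_single, smul_eq_mul, mul_one]
    rw [h, smul_mul_assoc, mul_smul_comm, single_mul_centralIdem hχ]
  set ε := ofFun (idemFun lam) with hε
  have hidem : centralIdem χ * ε * (centralIdem χ * ε) = centralIdem χ * ε := by
    rw [mul_assoc, ← mul_assoc ε, hcomm ε, mul_assoc, ofFun_idemFun_mul_self, ← mul_assoc,
      centralIdem_mul_self hχ]
  refine ⟨rangeSubrep _ (LinearMap.mulRight k (centralIdem χ * ε)) (regRep_comm _), fun g => ?_, ?_⟩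
  · apply LinearMap.ext
    rintro ⟨_, x, rfl⟩
    apply Subtype.ext
    rw [LinearMap.sum_apply, Submodule.coe_sum]
    change ∑ t, MonoidAlgebra.single (t * g * t⁻¹) 1 * (x * (centralIdem χ * ε)) =
      (Nat.card G * χ g / χ 1) • (x * (centralIdem χ * ε))
    rw [← mul_assoc x, hcomm x]
    simp only [← mul_assoc]
    rw [← Finset.sum_mul, ← Finset.sum_mul, sum_conj_mul_centralIdem hχ, smul_mul_assoc,
      smul_mul_assoc]
  · refine (finrank_toSubmodule_eq_trace _ (rangeSubrep _ _ (regRep_comm (centralIdem χ * ε)))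
      (LinearMap.mulRight k (centralIdem χ * ε)) ?_ fun v => LinearMap.mem_range_self _ v).trans ?_
    · rintro _ ⟨w, rfl⟩
      change w * (centralIdem χ * ε) * (centralIdem χ * ε) = w * (centralIdem χ * ε)
      rw [mul_assoc, hidem]
    · rw [trace_mulRight, centralIdem, hε, coeff_mul_ofFun_one]
      simp only [inv_inv, mul_assoc]
      rw [← Finset.mul_sum, ← mul_assoc, mul_div_cancel₀ _ hG]

end GroupAlgebra

end CharacterFields

namespace CharacterFields

theorem dvd_of_forall_prime_dvd_mul {δ d : ℕ} (hd : d ≠ 0)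
    (h : ∀ l : ℕ, l.Prime → ∃ m, ¬ l ∣ m ∧ δ ∣ d * m) : δ ∣ d := by
  have hg : 0 < δ.gcd d := Nat.gcd_pos_of_pos_right _ (Nat.pos_of_ne_zero hd)
  obtain ⟨a, b, hab, ha, hb⟩ := Nat.exists_coprime δ d
  by_cases h1 : a = 1
  · rw [ha, h1, one_mul]
    exact Nat.gcd_dvd_right _ _
  obtain ⟨l, hl, hla⟩ := Nat.exists_prime_and_dvd h1
  obtain ⟨m, hm, hdm⟩ := h l hl
  refine (hm (hla.trans (hab.dvd_of_dvd_mul_left (k := a) ?_))).elim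
  refine Nat.dvd_of_mul_dvd_mul_right hg ?_
  rwa [← ha, mul_right_comm, ← hb]

/-! ### Restriction of scalars and the divisibility criterion. -/

section Descent

variable {G : Type*} [Group G]

theorem exists_multiplicity_eq_natCast [Fintype G] {φ : G → ℂ} (hφ : IsChar φ) {H : Subgroup G}
    (lam : H →* ℂ) : ∃ m : ℕ, ∑ g, φ g * idemFun lam g = m := by
  classical
  obtain ⟨d, ρ, rfl⟩ := hφ
  have hcH : (Nat.card H : ℂ) ≠ 0 := Nat.cast_ne_zero.2 Nat.card_pos.ne'
  let _ : Invertible (Nat.card H : ℂ) := invertibleOfNonzero hcH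
  let ρH : Representation ℂ H (Fin d → ℂ) := ρ.comp H.subtype
  have h2 := Representation.card_inv_mul_sum_char_mul_char_eq_finrank (lamRep lam) ρH
  rw [character_lamRep] at h2
  exact ⟨_, (sum_mul_idemFun lam _).trans h2⟩

theorem exists_lift_linear {k : Type*} [Field k] [Algebra k ℂ] {H : Subgroup G} (lam : H →* ℂ)
    (h : ∀ x, ∃ c : k, algebraMap k ℂ c = lam x) :
    ∃ lam' : H →* k, ∀ g, algebraMap k ℂ (idemFun lam' g) = idemFun lam g := by
  choose f hf using h
  have hinj := (algebraMap k ℂ).injective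
  refine ⟨{ toFun := f
            map_one' := hinj (by rw [hf, map_one, map_one])
            map_mul' := fun x y => hinj (by rw [hf, map_mul, map_mul, hf, hf]) }, fun g => ?_⟩
  unfold idemFun
  split_ifs with hg
  · rw [map_mul, map_inv₀, map_natCast]
    congr 1
    exact hf _
  · exact map_zero _

/-- Restriction of scalars of a representation. -/
def restrictRep (F : Type*) {K V : Type*} [Field F] [Field K] [Algebra F K] [AddCommGroup V]
    [Module K V] [Module F V] [IsScalarTower F K V] (σ : Representation K G V) :
    Representation F G V where
  toFun g := (σ g).restrictScalars F
  map_one' := by rw [map_one]; rfl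
  map_mul' g h := by rw [map_mul]; rfl

theorem IsHomogeneous.restrictRep [Fintype G] {F K V : Type*} [Field F] [Field K] [Algebra F K]
    [AddCommGroup V] [Module K V] [Module F V] [IsScalarTower F K V] {χ : G → F}
    {σ : Representation K G V} (h : IsHomogeneous (fun g => algebraMap F K (χ g)) σ) :
    IsHomogeneous χ (restrictRep F σ) := fun g => by
  ext v
  have := LinearMap.congr_fun (h g) v
  rw [LinearMap.sum_apply, LinearMap.smul_apply, Module.End.one_apply, ← map_natCast (algebraMap F K),
    ← map_mul, ← map_div₀, algebraMap_smul] at this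
  rw [LinearMap.sum_apply]
  exact this

/-- There is a homogeneous representation of dimension `n`. -/
def HasHomogeneous {k : Type} [Field k] {G : Type u} [Group G] [Fintype G] (χ : G → k) (n : ℕ) :
    Prop :=
  ∃ (V : Type u) (_ : AddCommGroup V) (_ : Module k V) (_ : FiniteDimensional k V)
    (σ : Representation k G V), IsHomogeneous χ σ ∧ finrank k V = n

/-- Build the left ideal over K, where λ is defined, and regard it over F: the scalars of the class
sums already lie in F, and the dimension is multiplied by the degree of K over F. -/
theorem hasHomogeneous_of_linear {G : Type u} [Group G] [Fintype G] {F K : Type} [Field F]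
    [Field K] [Algebra F K] [Algebra F ℂ] [Algebra K ℂ] [IsScalarTower F K ℂ]
    [FiniteDimensional F K] {χ : G → F} (hχ : IsIrrChar fun g => algebraMap F ℂ (χ g))
    {H : Subgroup G} (lam : H →* ℂ) (hlam : ∀ x, ∃ c : K, algebraMap K ℂ c = lam x) {m : ℕ}
    (hm : ∑ g, algebraMap F ℂ (χ g) * idemFun lam g = m) :
    HasHomogeneous χ ((charDegree fun g => algebraMap F ℂ (χ g)) * (finrank F K * m)) := by
  have : CharZero K := (algebraMap K ℂ).charZero
  have hχ' : (fun g => algebraMap F ℂ (χ g)) =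
      fun g => algebraMap K ℂ ((fun g => algebraMap F K (χ g)) g) :=
    funext fun g => IsScalarTower.algebraMap_apply F K ℂ _
  have hχK := hχ
  rw [hχ'] at hχK
  obtain ⟨lam', hlam'⟩ := exists_lift_linear lam hlam
  obtain ⟨U, hU, hdim⟩ := exists_isHomogeneous hχK lam'
  have hfin : finrank K U.toSubmodule = (charDegree fun g => algebraMap F ℂ (χ g)) * m := by
    have h1 := congrArg (algebraMap K ℂ) hdim
    rw [map_natCast, map_mul, map_sum] at h1
    simp only [map_mul, hlam', ← IsScalarTower.algebraMap_apply] at h1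
    rw [hm, hχ.isChar.charDegree_eq] at h1
    exact_mod_cast h1
  refine ⟨U.toSubmodule, inferInstance, inferInstance, Module.Finite.trans K _,
    restrictRep F U.toRepresentation, hU.restrictRep, ?_⟩
  rw [← finrank_mul_finrank F K, hfin]
  ring

/-- The least positive homogeneous dimension divides χ(1)m for some m prime to l, for every prime l;
hence it divides χ(1), which forces the character to be χ. No division algebra is needed. -/
theorem exists_character_eq {k : Type} [Field k] [Algebra k ℂ] {G : Type u} [Group G] [Fintype G]
    {χ : G → k} (hχ : IsIrrChar fun g => algebraMap k ℂ (χ g))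
    (h : ∀ l : ℕ, l.Prime → ∃ m, ¬ l ∣ m ∧
      HasHomogeneous χ ((charDegree fun g => algebraMap k ℂ (χ g)) * m)) :
    ∃ (d : ℕ) (ρ : Representation k G (Fin d → k)), ρ.character = χ := by
  classical
  have : CharZero k := (algebraMap k ℂ).charZero
  have hd : (charDegree fun g => algebraMap k ℂ (χ g)) ≠ 0 := fun h0 =>
    map_one_ne_zero hχ (by rw [map_one_eq hχ, h0, Nat.cast_zero])
  have hex : ∃ n, 0 < n ∧ HasHomogeneous χ n := by
    obtain ⟨m, hm, hh⟩ := h 2 Nat.prime_two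
    exact ⟨_, Nat.mul_pos (Nat.pos_of_ne_zero hd)
      (Nat.pos_of_ne_zero fun h0 => hm (by rw [h0]; exact dvd_zero 2)), hh⟩
  obtain ⟨hpos, V, _, _, _, σ, hσ, hV⟩ := Nat.find_spec hex
  have hmin : ∀ n, HasHomogeneous χ n → n < finrank k V → n = 0 := fun n hn hlt => by
    by_contra hn0
    exact Nat.find_min hex (hV ▸ hlt) ⟨Nat.pos_of_ne_zero hn0, hn⟩
  rw [← hV] at hpos
  have : Nontrivial V := finrank_pos_iff.1 hpos
  have hdvd : finrank k V ∣ charDegree fun g => algebraMap k ℂ (χ g) := by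
    refine dvd_of_forall_prime_dvd_mul hd fun l hl => ?_
    obtain ⟨m, hm, W, _, _, _, τ, hτ, hW⟩ := h l hl
    exact ⟨m, hm, finrank_dvd_of_minimal hχ hσ
      (fun U hU => hmin _ ⟨_, _, _, inferInstance, _, hσ.toRepresentation U, rfl⟩ hU) _ hτ hW⟩
  obtain ⟨ρ', hρ'⟩ := exists_fin_rep σ
  exact ⟨_, ρ', hρ'.trans (hσ.character_eq_of_finrank_dvd hχ hdvd)⟩

end Descent

/-! ### Roots of unity and degrees of cyclotomic extensions. -/

section CyclotomicFields

theorem mem_cyclotomicSubfield {n : ℕ} (hn : n ≠ 0) {x : ℂ} (hx : x ^ n = 1) :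
    x ∈ cyclotomicSubfield n := by
  have : NeZero n := ⟨hn⟩
  obtain ⟨i, -, rfl⟩ := (Complex.isPrimitiveRoot_exp n hn).eq_pow_of_pow_eq_one hx
  exact pow_mem (IntermediateField.subset_adjoin _ _ (Set.mem_singleton _)) i

/-- The Galois group embeds in the units modulo n. Divisibility, and not just a bound, is what makes
the degree a power of 2 when n is one. -/
theorem exists_finrank_dvd_totient (F : IntermediateField ℚ ℂ) {n : ℕ} (hn : n ≠ 0) :
    ∃ K : IntermediateField F ℂ, FiniteDimensional F K ∧ finrank F K ∣ n.totient ∧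
      ∀ x : ℂ, x ^ n = 1 → x ∈ K := by
  have : NeZero n := ⟨hn⟩
  have hζ := Complex.isPrimitiveRoot_exp n hn
  let K := IntermediateField.adjoin F {Complex.exp (2 * Real.pi * Complex.I / n)}
  have hK : IsCyclotomicExtension {n} F K :=
    (IntermediateField.isCyclotomicExtension_singleton_iff_eq_adjoin (F := K) (hζ := hζ)).2 rfl
  have hfin : FiniteDimensional F K := IsCyclotomicExtension.finiteDimensional {n} F K
  have hgal : IsGalois F K := IsCyclotomicExtension.isGalois {n} F K
  refine ⟨K, hfin, ?_, fun x hx => ?_⟩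
  · rw [← IsGalois.card_aut_eq_finrank, ← ZMod.card_units_eq_totient, ← Nat.card_eq_fintype_card]
    exact Subgroup.card_dvd_of_injective _
      ((IsCyclotomicExtension.zeta_spec n F K).autToPow_injective F)
  · obtain ⟨i, -, rfl⟩ := hζ.eq_pow_of_pow_eq_one hx
    exact pow_mem (IntermediateField.subset_adjoin F _ (Set.mem_singleton _)) i

theorem mem_of_pow_mul_eq_one {S : Type*} [SetLike S ℂ] [SubfieldClass S ℂ] {K : S} {a b : ℕ}
    (hab : a.Coprime b) (ha : ∀ x : ℂ, x ^ a = 1 → x ∈ K) (hb : ∀ x : ℂ, x ^ b = 1 → x ∈ K)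
    {x : ℂ} (hx : x ^ (a * b) = 1) : x ∈ K := by
  by_cases hx0 : x = 0
  · rw [hx0]; exact zero_mem K
  have h := Nat.gcd_eq_gcd_ab a b
  rw [hab.gcd_eq_one] at h
  have h1 : x = (x ^ a) ^ a.gcdA b * (x ^ b) ^ a.gcdB b := by
    rw [← zpow_natCast, ← zpow_natCast, ← zpow_mul, ← zpow_mul, ← zpow_add₀ hx0, ← h]
    simp
  rw [h1]
  refine mul_mem (zpow_mem (hb _ ?_) _) (zpow_mem (ha _ ?_) _)
  · rw [← pow_mul, hx]
  · rw [← pow_mul, mul_comm, hx]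

end CyclotomicFields

/-! ### Assembling the theorem. -/

section Main

variable {G : Type*} [Group G]

/-- Norm one is an identity between elements of F, so it persists in every extension field and
implies irreducibility there. -/
theorem isAbsolutelyIrreducible_of_isIrrChar [Finite G] {F : IntermediateField ℚ ℂ} {d : ℕ}
    {ρ : Representation F G (Fin d → F)} {χ : G → ℂ} (hχ : IsIrrChar χ) (h : Affords ρ χ) :
    IsAbsolutelyIrreducible ρ := by
  have := Fintype.ofFinite G
  intro K _ _
  have : CharZero K := charZero_of_injective_algebraMap (algebraMap F K).injective
  refine isIrreducible_of_sum_eq_card _ ?_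
  have h1 : ∀ g, (scalarExt K ρ).character g = algebraMap F K (ρ.character g) := fun g =>
    LinearMap.trace_baseChange (ρ g) K
  simp only [h1, ← map_mul]
  rw [← map_sum, ← map_natCast (algebraMap F K)]
  congr 1
  refine (algebraMap F ℂ).injective ?_
  rw [map_natCast, map_sum, ← (hχ.sum_mul hχ).trans (if_pos rfl)]
  refine Finset.sum_congr rfl fun g _ => ?_
  rw [map_mul, ← h g, ← h g⁻¹]
  rfl

theorem schurIndex_eq_one {F : IntermediateField ℚ ℂ} {χ : G → ℂ} (hF : fieldOfValues χ ≤ F)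
    {d : ℕ} {ρ : Representation F G (Fin d → F)} (h : Affords ρ χ) : schurIndex F χ = 1 := by
  have hF' : F ⊔ fieldOfValues χ = F := sup_eq_left.2 hF
  unfold schurIndex
  rw [hF']
  refine le_antisymm (Nat.sInf_le ⟨le_rfl, d, ρ, ?_⟩) ?_
  · simpa using h
  -- The infimum of an empty set of naturals is 0, so the lower bound also needs the witness 1.
  · exact (Nat.sInf_mem ⟨1, le_rfl, d, ρ, by simpa using h⟩ : _ ∈ {m : ℕ | 1 ≤ m ∧ _}).1

theorem exists_affords [Fintype G] {M : Ideal AlgInt} (hM : M.IsPrime)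
    (h2 : ((2 : ℕ) : AlgInt) ∈ M) {χ : G → ℂ} (hχ : IsIrrChar χ) (h0 : charHeight 2 M χ = 0)
    {F : IntermediateField ℚ ℂ} (hval : fieldOfValues χ ≤ F)
    (hcyc : cyclotomicSubfield (ordCompl[2] (Nat.card G)) ≤ F) :
    ∃ (d : ℕ) (ρ : Representation F G (Fin d → F)), Affords ρ χ := by
  have hn : ordCompl[2] (Nat.card G) ≠ 0 := (Nat.ordCompl_pos 2 Nat.card_pos.ne').ne'
  let χF : G → F := fun g => ⟨χ g, hval (IntermediateField.subset_adjoin _ _ ⟨g, rfl⟩)⟩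
  have hχF : IsIrrChar fun g => algebraMap F ℂ (χF g) := hχ
  have hpow : ∀ {H : Subgroup G} (lam : H →* ℂ) (x : H), lam x ^ Nat.card H = 1 := fun lam x => by
    rw [← map_pow, pow_card_eq_one', map_one]
  obtain ⟨d, ρ, hρ⟩ := exists_character_eq hχF fun l hl => by
    have : Fact l.Prime := ⟨hl⟩
    rcases eq_or_ne l 2 with rfl | hl2
    -- H has odd order, so λ takes values in ℚ_n ⊆ F and no extension of scalars is needed.
    · obtain ⟨H, lam, hH, hm⟩ := exists_multiplicity_not_dvd_of_height_zero hM h2 hχ h0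
      obtain ⟨m, hm'⟩ := exists_multiplicity_eq_natCast hχ.isChar lam
      have hlam : ∀ x, ∃ c : F, algebraMap F ℂ c = lam x := fun x => by
        refine ⟨⟨lam x, hcyc (mem_cyclotomicSubfield hn ?_)⟩, rfl⟩
        obtain ⟨c, hc⟩ : Nat.card H ∣ ordCompl[2] (Nat.card G) := by
          refine Nat.Coprime.dvd_of_dvd_mul_left (hH.symm.pow_right ((Nat.card G).factorization 2)) ?_
          rw [Nat.ordProj_mul_ordCompl_eq_self]
          exact Subgroup.card_subgroup_dvd_card H
        rw [hc, pow_mul, hpow, one_pow]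
      refine ⟨m, fun ⟨c, hc⟩ => hm ⟨c, by rw [hm', hc]⟩, ?_⟩
      have := hasHomogeneous_of_linear hχF lam hlam hm'
      rwa [finrank_self, one_mul] at this
    -- The values of λ are |G|-th roots of unity: the odd part lies in F, the 2-part in K. The
    -- degree of K over F divides the totient of a power of 2, so it is prime to the odd prime l.
    · obtain ⟨H, lam, hm⟩ := exists_multiplicity_not_dvd (l := l) hχ
      obtain ⟨m, hm'⟩ := exists_multiplicity_eq_natCast hχ.isChar lam
      obtain ⟨K, _, hK, hKmem⟩ := exists_finrank_dvd_totient F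
        (n := ordProj[2] (Nat.card G)) (Nat.ordProj_pos _ _).ne'
      have hlam : ∀ x, ∃ c : K, algebraMap K ℂ c = lam x := fun x => by
        refine ⟨⟨lam x, mem_of_pow_mul_eq_one (Nat.coprime_ordCompl Nat.prime_two
          Nat.card_pos.ne' |>.pow_left _) hKmem (fun y hy => K.algebraMap_mem
          (⟨y, hcyc (mem_cyclotomicSubfield hn hy)⟩ : F)) ?_⟩, rfl⟩
        rw [Nat.ordProj_mul_ordCompl_eq_self]
        obtain ⟨c, hc⟩ := Subgroup.card_subgroup_dvd_card H
        rw [hc, pow_mul, hpow, one_pow]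
      refine ⟨_, fun hdvd => ?_, hasHomogeneous_of_linear hχF lam hlam hm'⟩
      rcases (hl.dvd_mul).1 hdvd with h | ⟨c, hc⟩
      · have h3 := h.trans hK
        rcases Nat.eq_zero_or_pos ((Nat.card G).factorization 2) with ha | ha
        · rw [ha, pow_zero, Nat.totient_one] at h3
          exact hl.one_lt.ne' (Nat.dvd_one.1 h3)
        · rw [Nat.totient_prime_pow Nat.prime_two ha, Nat.add_one_sub_one, mul_one] at h3
          exact hl2 ((Nat.prime_dvd_prime_iff_eq hl Nat.prime_two).1 (hl.dvd_of_dvd_pow h3))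
      · exact hm ⟨c, by rw [hm', hc]⟩
  exact ⟨d, ρ, fun g => by rw [hρ]⟩

end Main

end CharacterFields

theorem mainTheorem9 {G : Type*} [Group G] [Finite G]
    (M : Ideal CharacterFields.AlgInt) (hM : M.IsMaximal)
    (h2 : (2 : CharacterFields.AlgInt) ∈ M)
    (χ : G → ℂ) (hχ : CharacterFields.IsIrrChar χ)
    (hχ0 : CharacterFields.charHeight 2 M χ = 0)
    (n : ℕ) (hn : n = ordCompl[2] (Nat.card G))
    (F : IntermediateField ℚ ℂ)
    (hF : F = CharacterFields.cyclotomicSubfield n ⊔ CharacterFields.fieldOfValues χ) :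
    (∃ (d : ℕ) (ρ : Representation F G (Fin d → F)),
      CharacterFields.IsAbsolutelyIrreducible ρ ∧ CharacterFields.Affords ρ χ) ∧
    CharacterFields.schurIndex F χ = 1 := by
  have := Fintype.ofFinite G
  have hval : CharacterFields.fieldOfValues χ ≤ F := hF ▸ le_sup_right
  have hcyc : CharacterFields.cyclotomicSubfield (ordCompl[2] (Nat.card G)) ≤ F := by
    rw [← hn, hF]
    exact le_sup_left
  obtain ⟨d, ρ, h⟩ := CharacterFields.exists_affords hM.isPrime (by exact_mod_cast h2) hχ hχ0
    hval hcyc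
  exact ⟨⟨d, ρ, CharacterFields.isAbsolutelyIrreducible_of_isIrrChar hχ h, h⟩,
    CharacterFields.schurIndex_eq_one hval h⟩
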